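/- Let $q>0$ be a real number, $q\neq 1$, and $[x]_q:=\frac{q^x-q^{-x}}{q-q^{-1}}$. Let $U_q(\mathrm{su}_2)$ be the complex algebra with generators $E,F,K,K^{-1}$ and relations $KK^{-1}=K^{-1}K=1$, $KE=qEK$, $FK=qKF$, $EF-FE=\frac{1}{q-q^{-1}}(K^2-K^{-2})$, with antipode $S(E)=-qE$, $S(F)=-q^{-1}F$, $S(K)=K^{-1}$. Let $\mathcal O(\mathrm{SU}_q(2))$ be the complex $*$-algebra with generators $a,b,c,d$ and relations $ab=qba$, $ac=qca$, $bd=qdb$, $cd=qdc$, $bc=cb$, $ad-qbc=1=da-q^{-1}bc$, with involution $a^*=d$, $b^*=-qc$, and counit $\varepsilon(a)=\varepsilon(d)=1$, $\varepsilon(b)=\varepsilon(c)=0$. For $l\in\frac12\mathbb N_0$ and $j,k\in\{-l,-l+1,\dots,l\}$ let $t^l_{jk}$ be the matrix elements of the spin-$l$ unitary corepresentation, with $\begin{pmatrix}a&b\\c&d\end{pmatrix}=(t^{1/2}_{jk})_{j,k=-1/2,1/2}$; put $v^l_{jk}:=[2l+1]_q^{1/2}q^jt^l_{jk}$ and $\alpha^l_k:=([l-k]_q[l+k+1]_q)^{1/2}$.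 There are representations $f\mapsto f\triangleright\,\cdot\,$ and $f\mapsto\partial_f$ of $U_q(\mathrm{su}_2)$ on $\mathcal O(\mathrm{SU}_q(2))$ given by $$E\triangleright v^l_{jk}=\alpha^l_kv^l_{j,k+1},\quad F\triangleright v^l_{jk}=\alpha^l_{k-1}v^l_{j,k-1},\quad K\triangleright v^l_{jk}=q^kv^l_{jk},$$ $$\partial_E(v^l_{jk})=-\alpha^l_{j-1}v^l_{j-1,k},\quad \partial_F(v^l_{jk})=-\alpha^l_jv^l_{j+1,k},\quad \partial_K(v^l_{jk})=q^{-j}v^l_{jk};$$ these relations, together with $t^l_{-l,-l}=a^{2l}$, determine the $t^l_{jk}$. The standard Podleś sphere is the subalgebra $\mathcal O(\mathrm S^2_q):=\{x\in\mathcal O(\mathrm{SU}_q(2)):\partial_{K^2}(x)=x\}$. Let $\theta$ be its automorphism $\theta(y)=K^{-2}\triangleright y$ (the modular automorphism of the Haar state), so $\theta^{-1}(y)=K^2\triangleright y$. Let $\sigma_l:U_q(\mathrm{su}_2)\to M_{2l+1}(\mathbb C)$ be the spin-$l$ representation, $\sigma_l(E)_{jk}=\alpha^l_k\delta_{j,k+1}$,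 $\sigma_l(F)_{jk}=\alpha^l_{k-1}\delta_{j,k-1}$, $\sigma_l(K)_{jk}=q^k\delta_{jk}$, and put $\rho^\circ_l(f):=\sigma_l(K^{-1}S(f)K)$. For $N\in\mathbb Z$ set $n=N/2$, $l=|N|/2$, let $\mathbf t^l_n=(t^l_{n,-l},\dots,t^l_{n,l})$ (a row vector, so $\mathbf t^{l*}_n$ is a column vector) and $$P_N:=\rho^\circ_l(K^{-1})\,\mathbf t^{l*}_n\,\mathbf t^l_n\,\rho^\circ_l(K)\in M_{|N|+1}(\mathcal O(\mathrm S^2_q)).$$ For $X,Y,Z\in M_{|N|+1}(\mathcal O(\mathrm S^2_q))$ let $$\mathrm{Tr}_{\theta^{-1}}(X\otimes Y\otimes Z):=\sum_{j_0,j_1,j_2,j_3}\rho^\circ_l(K^2)_{j_3j_0}\,X_{j_0j_1}\otimes Y_{j_1j_2}\otimes Z_{j_2j_3},$$ and let $b_2^{\theta^{-1}}:\mathcal O(\mathrm S^2_q)^{\otimes3}\to\mathcal O(\mathrm S^2_q)^{\otimes2}$ be the linear map $$b_2^{\theta^{-1}}(x\otimes y\otimes z)=xy\otimes z-x\otimes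 yz+\theta^{-1}(z)x\otimes y.$$ Then for every $N\in\mathbb Z$ the element $$\overline{\mathrm{ch}}{}_2^{\theta^{-1}}(P_N):=\mathrm{Tr}_{\theta^{-1}}\big((1-2P_N)\otimes(P_N-\varepsilon(P_N))\otimes(P_N-\varepsilon(P_N))\big)\in\mathcal O(\mathrm S^2_q)^{\otimes3},$$ where $\varepsilon$ is applied to each entry of $P_N$, is a $\theta^{-1}$-twisted Hochschild $2$-cycle, that is, $b_2^{\theta^{-1}}\big(\overline{\mathrm{ch}}{}_2^{\theta^{-1}}(P_N)\big)=0$. -/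

import Mathlib

open scoped TensorProduct

noncomputable section

namespace Podles

set_option linter.unusedSimpArgs false
set_option linter.unnecessarySeqFocus false

/-! ### The deformation parameter and `q`-numbers -/

/-- The deformation parameter: a positive real number `q ≠ 1`. -/
abbrev Param := {q : ℝ // 0 < q ∧ q ≠ 1}

/-- The real power `q ^ x`, as a complex number. -/
def qpow (q : Param) (x : ℝ) : ℂ := ((q.1 ^ x : ℝ) : ℂ)

/-- The `q`-number `[x]_q = (q^x - q^(-x)) / (q - q⁻¹)`. -/
def qnum (q : Param) (x : ℝ) : ℝ := (q.1 ^ x - q.1 ^ (-x)) / (q.1 - q.1⁻¹)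

/-- The coefficient `α^l_k = ([l - k]_q [l + k + 1]_q)^(1/2)` for `l = m / 2`, `k = s - m / 2`,
so that `l - k = m - s` and `l + k + 1 = s + 1`. -/
def alpha (q : Param) (m s : ℕ) : ℝ := Real.sqrt (qnum q ((m : ℝ) - s) * qnum q ((s : ℝ) + 1))

lemma qpow_add (q : Param) (x y : ℝ) : qpow q (x + y) = qpow q x * qpow q y := by
  simp [qpow, Real.rpow_add q.2.1]

lemma qpow_zero (q : Param) : qpow q 0 = 1 := by simp [qpow]

lemma qpow_ne (q : Param) (x : ℝ) : qpow q x ≠ 0 := by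
  simpa [qpow] using (Real.rpow_pos_of_pos q.2.1 x).ne'

lemma qpow_mul_neg (q : Param) (x : ℝ) : qpow q x * qpow q (-x) = 1 := by
  rw [← qpow_add, add_neg_cancel, qpow_zero]

lemma qpow_neg_mul (q : Param) (x : ℝ) : qpow q (-x) * qpow q x = 1 := by
  rw [← qpow_add, neg_add_cancel, qpow_zero]

lemma conj_qpow (q : Param) (x : ℝ) : (starRingEnd ℂ) (qpow q x) = qpow q x := by
  simp [qpow]

lemma qnum_nonneg (q : Param) {x : ℝ} (hx : 0 ≤ x) : 0 ≤ qnum q x := by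
  obtain ⟨q, h0, h1⟩ := q
  unfold qnum
  rcases lt_or_gt_of_ne h1 with h | h
  · apply div_nonneg_of_nonpos
    · have := Real.rpow_le_rpow_of_exponent_ge h0 h.le (show -x ≤ x by linarith)
      simpa using this
    · have := (one_lt_inv₀ h0).2 h
      simp only; linarith
  · apply div_nonneg
    · have := Real.rpow_le_rpow_of_exponent_le h.le (show -x ≤ x by linarith)
      simpa using this
    · have := inv_lt_one_of_one_lt₀ h
      simp only; linarith

/-! ### The Hopf algebra `U_q(su_2)` -/

/-- Generators of `U_q(su_2)`. -/
inductive UGen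
  | E | F | K | Kinv

/-- Defining relations of `U_q(su_2)`. -/
inductive URel (q : Param) : FreeAlgebra ℂ UGen → FreeAlgebra ℂ UGen → Prop
  | KKinv : URel q (FreeAlgebra.ι ℂ UGen.K * FreeAlgebra.ι ℂ UGen.Kinv) 1
  | KinvK : URel q (FreeAlgebra.ι ℂ UGen.Kinv * FreeAlgebra.ι ℂ UGen.K) 1
  | KE : URel q (FreeAlgebra.ι ℂ UGen.K * FreeAlgebra.ι ℂ UGen.E)
      (qpow q 1 • (FreeAlgebra.ι ℂ UGen.E * FreeAlgebra.ι ℂ UGen.K))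
  | FK : URel q (FreeAlgebra.ι ℂ UGen.F * FreeAlgebra.ι ℂ UGen.K)
      (qpow q 1 • (FreeAlgebra.ι ℂ UGen.K * FreeAlgebra.ι ℂ UGen.F))
  | EF : URel q
      (FreeAlgebra.ι ℂ UGen.E * FreeAlgebra.ι ℂ UGen.F
        - FreeAlgebra.ι ℂ UGen.F * FreeAlgebra.ι ℂ UGen.E)
      ((qpow q 1 - qpow q (-1))⁻¹ •
        (FreeAlgebra.ι ℂ UGen.K ^ 2 - FreeAlgebra.ι ℂ UGen.Kinv ^ 2))

/-- The algebra `U_q(su_2)`. -/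
def U (q : Param) : Type := RingQuot (URel q)

instance (q : Param) : Ring (U q) := inferInstanceAs (Ring (RingQuot (URel q)))
instance (q : Param) : Algebra ℂ (U q) := inferInstanceAs (Algebra ℂ (RingQuot (URel q)))

/-- The quotient map from the free algebra onto `U_q(su_2)`. -/
def U.mk (q : Param) : FreeAlgebra ℂ UGen →ₐ[ℂ] U q := RingQuot.mkAlgHom ℂ (URel q)

lemma U.mk_rel {q : Param} {x y : FreeAlgebra ℂ UGen} (h : URel q x y) : U.mk q x = U.mk q y :=
  RingQuot.mkAlgHom_rel ℂ h

/-- The image of a generator in `U_q(su_2)`. -/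
def U.gen (q : Param) (x : UGen) : U q := U.mk q (FreeAlgebra.ι ℂ x)

/-- The generator `E`. -/
abbrev U.E (q : Param) : U q := U.gen q UGen.E
/-- The generator `F`. -/
abbrev U.F (q : Param) : U q := U.gen q UGen.F
/-- The generator `K`. -/
abbrev U.K (q : Param) : U q := U.gen q UGen.K
/-- The generator `K⁻¹`. -/
abbrev U.Kinv (q : Param) : U q := U.gen q UGen.Kinv

lemma U.K_mul_Kinv (q : Param) : U.K q * U.Kinv q = 1 := by
  simpa [U.gen] using U.mk_rel (URel.KKinv (q := q))

lemma U.Kinv_mul_K (q : Param) : U.Kinv q * U.K q = 1 := by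
  simpa [U.gen] using U.mk_rel (URel.KinvK (q := q))

lemma U.K_mul_E (q : Param) : U.K q * U.E q = qpow q 1 • (U.E q * U.K q) := by
  simpa [U.gen] using U.mk_rel (URel.KE (q := q))

lemma U.F_mul_K (q : Param) : U.F q * U.K q = qpow q 1 • (U.K q * U.F q) := by
  simpa [U.gen] using U.mk_rel (URel.FK (q := q))

lemma U.E_mul_F (q : Param) : U.E q * U.F q - U.F q * U.E q
    = (qpow q 1 - qpow q (-1))⁻¹ • (U.K q ^ 2 - U.Kinv q ^ 2) := by
  simpa only [U.gen, map_mul, map_sub, map_smul, map_pow] using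
    U.mk_rel (URel.EF (q := q))

/-- The universal property of `U_q(su_2)`. -/
def U.lift (q : Param) {B : Type*} [Ring B] [Algebra ℂ B] (e f k k' : B)
    (h1 : k * k' = 1) (h2 : k' * k = 1) (h3 : k * e = qpow q 1 • (e * k))
    (h4 : f * k = qpow q 1 • (k * f))
    (h5 : e * f - f * e = (qpow q 1 - qpow q (-1))⁻¹ • (k ^ 2 - k' ^ 2)) : U q →ₐ[ℂ] B :=
  RingQuot.liftAlgHom ℂ ⟨FreeAlgebra.lift ℂ (fun x : UGen => match x with
    | .E => e | .F => f | .K => k | .Kinv => k'), by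
    intro x y h
    induction h <;> simp [h1, h2, h3, h4, h5]⟩

lemma U.lift_mk (q : Param) {B : Type*} [Ring B] [Algebra ℂ B] (e f k k' : B)
    (h1 : k * k' = 1) (h2 : k' * k = 1) (h3 : k * e = qpow q 1 • (e * k))
    (h4 : f * k = qpow q 1 • (k * f))
    (h5 : e * f - f * e = (qpow q 1 - qpow q (-1))⁻¹ • (k ^ 2 - k' ^ 2))
    (x : FreeAlgebra ℂ UGen) :
    U.lift q e f k k' h1 h2 h3 h4 h5 (U.mk q x) = FreeAlgebra.lift ℂ (fun x : UGen => match x with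
      | .E => e | .F => f | .K => k | .Kinv => k') x :=
  RingQuot.liftAlgHom_mkAlgHom_apply ..

section
variable (q : Param) {B : Type*} [Ring B] [Algebra ℂ B] {e f k k' : B}
    (h1 : k * k' = 1) (h2 : k' * k = 1) (h3 : k * e = qpow q 1 • (e * k))
    (h4 : f * k = qpow q 1 • (k * f))
    (h5 : e * f - f * e = (qpow q 1 - qpow q (-1))⁻¹ • (k ^ 2 - k' ^ 2))

lemma U.lift_E : U.lift q e f k k' h1 h2 h3 h4 h5 (U.E q) = e := by
  simp [U.gen, U.lift_mk]
lemma U.lift_F : U.lift q e f k k' h1 h2 h3 h4 h5 (U.F q) = f := by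
  simp [U.gen, U.lift_mk]
lemma U.lift_K : U.lift q e f k k' h1 h2 h3 h4 h5 (U.K q) = k := by
  simp [U.gen, U.lift_mk]
lemma U.lift_Kinv : U.lift q e f k k' h1 h2 h3 h4 h5 (U.Kinv q) = k' := by
  simp [U.gen, U.lift_mk]

end

open MulOpposite in
/-- The antipode of `U_q(su_2)`, as a homomorphism into the opposite algebra:
`S(E) = -q E`, `S(F) = -q⁻¹ F`, `S(K) = K⁻¹`. -/
def U.antipode (q : Param) : U q →ₐ[ℂ] (U q)ᵐᵒᵖ :=
  U.lift q (op (-(qpow q 1 • U.E q))) (op (-(qpow q (-1) • U.F q))) (op (U.Kinv q)) (op (U.K q))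
    (by rw [← op_mul, U.K_mul_Kinv, op_one])
    (by rw [← op_mul, U.Kinv_mul_K, op_one])
    (by
      rw [← op_mul, ← op_mul, ← op_smul]
      refine congrArg op ?_
      have h : U.E q * U.Kinv q = qpow q 1 • (U.Kinv q * U.E q) := by
        calc U.E q * U.Kinv q = U.Kinv q * (U.K q * U.E q) * U.Kinv q := by
              rw [← mul_assoc, U.Kinv_mul_K, one_mul]
          _ = qpow q 1 • (U.Kinv q * U.E q * (U.K q * U.Kinv q)) := by
              rw [U.K_mul_E]; simp [mul_assoc]
          _ = _ := by rw [U.K_mul_Kinv, mul_one]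
      simp [h, smul_smul])
    (by
      rw [← op_mul, ← op_mul, ← op_smul]
      refine congrArg op ?_
      have h : U.Kinv q * U.F q = qpow q 1 • (U.F q * U.Kinv q) := by
        calc U.Kinv q * U.F q = U.Kinv q * (U.F q * U.K q) * U.Kinv q := by
              rw [mul_assoc, mul_assoc, U.K_mul_Kinv, mul_one]
          _ = qpow q 1 • ((U.Kinv q * U.K q) * U.F q * U.Kinv q) := by
              rw [U.F_mul_K]; simp [mul_assoc]
          _ = _ := by rw [U.Kinv_mul_K, one_mul]
      simp [h, smul_smul, mul_comm])
    (by
      rw [← op_mul, ← op_mul, ← op_pow, ← op_pow, ← op_sub, ← op_sub, ← op_smul]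
      refine congrArg op ?_
      have h := U.E_mul_F q
      simp only [neg_mul_neg, smul_mul_smul_comm, qpow_mul_neg, qpow_neg_mul, one_smul]
      rw [← neg_sub, h, ← smul_neg, neg_sub])

/-! ### The spin-`l` representations, `l = m / 2`

The weight vectors are indexed by `s : Fin (m + 1)`; the index `s` stands for the weight
`k = s - m / 2 ∈ {-l, …, l}`. -/

/-- The matrix of `E`: `E v_k = α_k v_{k+1}`. -/
def spinE (q : Param) (m : ℕ) : Matrix (Fin (m + 1)) (Fin (m + 1)) ℂ :=
  fun i j => if (i : ℕ) = j + 1 then (alpha q m j : ℂ) else 0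

/-- The matrix of `F`: `F v_k = α_{k-1} v_{k-1}`. -/
def spinF (q : Param) (m : ℕ) : Matrix (Fin (m + 1)) (Fin (m + 1)) ℂ :=
  fun i j => if (i : ℕ) + 1 = j then (alpha q m i : ℂ) else 0

/-- The matrix of `K^z`: `K^z v_k = q^(z k) v_k`. -/
def spinK (q : Param) (m : ℕ) (z : ℝ) : Matrix (Fin (m + 1)) (Fin (m + 1)) ℂ :=
  Matrix.diagonal fun i => qpow q (z * ((i : ℝ) - m / 2))

lemma spinK_mul (q : Param) (m : ℕ) (y z : ℝ) : spinK q m y * spinK q m z = spinK q m (y + z) := by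
  simp [spinK, ← qpow_add, add_mul]

lemma spinK_zero (q : Param) (m : ℕ) : spinK q m 0 = 1 := by
  simp [spinK, qpow_zero]

lemma alpha_sq (q : Param) {m s : ℕ} (h : s ≤ m) :
    (alpha q m s : ℂ) * alpha q m s = (qnum q ((m : ℝ) - s) * qnum q ((s : ℝ) + 1) : ℝ) := by
  rw [← Complex.ofReal_mul, alpha, Real.mul_self_sqrt]
  exact mul_nonneg (qnum_nonneg q (by simpa using h)) (qnum_nonneg q (by positivity))

lemma qnum_identity (q : Param) (m s : ℝ) :
    ((qnum q (m - (s - 1)) * qnum q s : ℝ) : ℂ) - (qnum q (m - s) * qnum q (s + 1) : ℝ)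
      = (qpow q 1 - qpow q (-1))⁻¹ * (qpow q (2 * (s - m / 2)) - qpow q (-2 * (s - m / 2))) := by
  obtain ⟨q, h0, h1⟩ := q
  have hne : q - q⁻¹ ≠ 0 := by
    intro h
    have h2 : q * q = 1 := by
      have : q = q⁻¹ := by linarith
      calc q * q = q * q⁻¹ := by rw [← this]
        _ = 1 := mul_inv_cancel₀ h0.ne'
    exact h1 (by nlinarith)
  have key : (q ^ (m - (s - 1)) - q ^ (-(m - (s - 1)))) * (q ^ s - q ^ (-s))
      - (q ^ (m - s) - q ^ (-(m - s))) * (q ^ (s + 1) - q ^ (-(s + 1)))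
      = (q ^ (1 : ℝ) - q ^ (-1 : ℝ)) * (q ^ (2 * (s - m / 2)) - q ^ (-2 * (s - m / 2))) := by
    simp only [mul_sub, sub_mul, ← Real.rpow_add h0]
    ring_nf
  rw [Real.rpow_one, Real.rpow_neg_one] at key
  have main : qnum ⟨q, h0, h1⟩ (m - (s - 1)) * qnum ⟨q, h0, h1⟩ s
      - qnum ⟨q, h0, h1⟩ (m - s) * qnum ⟨q, h0, h1⟩ (s + 1)
      = (q ^ (1 : ℝ) - q ^ (-1 : ℝ))⁻¹ * (q ^ (2 * (s - m / 2)) - q ^ (-2 * (s - m / 2))) := by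
    simp only [qnum]
    rw [Real.rpow_one, Real.rpow_neg_one, div_mul_div_comm, div_mul_div_comm, ← sub_div, key,
      mul_div_mul_left _ _ hne, div_eq_inv_mul]
  simp only [qpow, ← Complex.ofReal_sub, ← Complex.ofReal_inv, ← Complex.ofReal_mul, main]

lemma qnum_zero (q : Param) : qnum q 0 = 0 := by simp [qnum]

lemma spinE_mul_spinF (q : Param) (m : ℕ) :
    spinE q m * spinF q m = Matrix.diagonal fun i : Fin (m + 1) =>
      ((qnum q ((m : ℝ) - ((i : ℝ) - 1)) * qnum q (i : ℝ) : ℝ) : ℂ) := by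
  ext i j
  rw [Matrix.mul_apply]
  obtain ⟨i, hi⟩ := i
  obtain ⟨j, hj⟩ := j
  rcases i with _ | i
  · simp [spinE, Matrix.diagonal_apply, qnum_zero]
  · rw [Finset.sum_eq_single ⟨i, by omega⟩]
    · simp only [spinE, spinF, Matrix.diagonal_apply, Fin.mk.injEq, if_true]
      split_ifs with h
      · rw [alpha_sq q (by omega)]
        push_cast
        congr 2
        ring_nf
      · simp
    · rintro ⟨b, hb⟩ - hne
      simp only [spinE]
      rw [if_neg, zero_mul]
      intro h
      exact hne (by ext; simp at h ⊢; omega)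
    · simp

lemma spinF_mul_spinE (q : Param) (m : ℕ) :
    spinF q m * spinE q m = Matrix.diagonal fun i : Fin (m + 1) =>
      ((qnum q ((m : ℝ) - (i : ℝ)) * qnum q ((i : ℝ) + 1) : ℝ) : ℂ) := by
  ext i j
  rw [Matrix.mul_apply]
  obtain ⟨i, hi⟩ := i
  obtain ⟨j, hj⟩ := j
  rcases Nat.lt_or_ge i m with him | him
  · rw [Finset.sum_eq_single ⟨i + 1, by omega⟩]
    · simp only [spinE, spinF, Matrix.diagonal_apply, Fin.mk.injEq, if_true]
      by_cases h : i = j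
      · subst h
        simp only [if_true]
        rw [alpha_sq q (by omega)]
      · rw [if_neg h, if_neg (by omega), mul_zero]
    · rintro ⟨b, hb⟩ - hne
      simp only [spinF]
      rw [if_neg, zero_mul]
      intro h
      exact hne (by ext; simp at h ⊢; omega)
    · simp
  · have : i = m := by omega
    subst this
    rw [Finset.sum_eq_zero]
    · simp [Matrix.diagonal_apply, qnum_zero]
    · rintro ⟨b, hb⟩ -
      simp only [spinF]
      rw [if_neg (by omega), zero_mul]

/-- The spin-`m / 2` representation `σ_{m/2}` of `U_q(su_2)`. -/
def sigma (q : Param) (m : ℕ) : U q →ₐ[ℂ] Matrix (Fin (m + 1)) (Fin (m + 1)) ℂ :=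
  U.lift q (spinE q m) (spinF q m) (spinK q m 1) (spinK q m (-1))
    (by rw [spinK_mul, add_neg_cancel, spinK_zero])
    (by rw [spinK_mul, neg_add_cancel, spinK_zero])
    (by
      ext i j
      simp only [spinK, spinE, Matrix.diagonal_mul, Matrix.mul_diagonal, Matrix.smul_apply,
        smul_eq_mul]
      split_ifs with h
      · rw [h, mul_left_comm, ← qpow_add, mul_comm]
        congr 2; push_cast; ring
      · simp)
    (by
      ext i j
      simp only [spinK, spinF, Matrix.diagonal_mul, Matrix.mul_diagonal, Matrix.smul_apply,
        smul_eq_mul]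
      split_ifs with h
      · rw [← h, ← mul_assoc, ← qpow_add, mul_comm]
        congr 2; push_cast; ring
      · simp)
    (by
      have hEF := spinE_mul_spinF q m
      have hFE := spinF_mul_spinE q m
      rw [hEF, hFE, pow_two, pow_two, spinK_mul, spinK_mul, Matrix.diagonal_sub]
      simp only [spinK, Matrix.diagonal_sub, ← Matrix.diagonal_smul]
      congr 1
      funext i
      rw [qnum_identity]
      simp only [Pi.smul_apply, smul_eq_mul]
      norm_num)

/-- The anti-representation `ρ°_{m/2}(f) = σ_{m/2}(K⁻¹ S(f) K)` of `U_q(su_2)`. -/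
def rho (q : Param) (m : ℕ) (f : U q) : Matrix (Fin (m + 1)) (Fin (m + 1)) ℂ :=
  sigma q m (U.Kinv q * (U.antipode q f).unop * U.K q)

/-! ### The coordinate algebra of quantum `SU(2)` -/

/-- Generators of `O(SU_q(2))`, the entries of the fundamental matrix `(a b; c d)`. -/
inductive AGen
  | a | b | c | d

/-- Defining relations of `O(SU_q(2))`. -/
inductive ARel (q : Param) : FreeAlgebra ℂ AGen → FreeAlgebra ℂ AGen → Prop
  | ab : ARel q (FreeAlgebra.ι ℂ AGen.a * FreeAlgebra.ι ℂ AGen.b)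
      (qpow q 1 • (FreeAlgebra.ι ℂ AGen.b * FreeAlgebra.ι ℂ AGen.a))
  | ac : ARel q (FreeAlgebra.ι ℂ AGen.a * FreeAlgebra.ι ℂ AGen.c)
      (qpow q 1 • (FreeAlgebra.ι ℂ AGen.c * FreeAlgebra.ι ℂ AGen.a))
  | bd : ARel q (FreeAlgebra.ι ℂ AGen.b * FreeAlgebra.ι ℂ AGen.d)
      (qpow q 1 • (FreeAlgebra.ι ℂ AGen.d * FreeAlgebra.ι ℂ AGen.b))
  | cd : ARel q (FreeAlgebra.ι ℂ AGen.c * FreeAlgebra.ι ℂ AGen.d)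
      (qpow q 1 • (FreeAlgebra.ι ℂ AGen.d * FreeAlgebra.ι ℂ AGen.c))
  | bc : ARel q (FreeAlgebra.ι ℂ AGen.b * FreeAlgebra.ι ℂ AGen.c)
      (FreeAlgebra.ι ℂ AGen.c * FreeAlgebra.ι ℂ AGen.b)
  | ad : ARel q (FreeAlgebra.ι ℂ AGen.a * FreeAlgebra.ι ℂ AGen.d)
      (1 + qpow q 1 • (FreeAlgebra.ι ℂ AGen.b * FreeAlgebra.ι ℂ AGen.c))
  | da : ARel q (FreeAlgebra.ι ℂ AGen.d * FreeAlgebra.ι ℂ AGen.a)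
      (1 + qpow q (-1) • (FreeAlgebra.ι ℂ AGen.b * FreeAlgebra.ι ℂ AGen.c))

/-- The coordinate algebra `O(SU_q(2))`. -/
def A (q : Param) : Type := RingQuot (ARel q)

instance (q : Param) : Ring (A q) := inferInstanceAs (Ring (RingQuot (ARel q)))
instance (q : Param) : Algebra ℂ (A q) := inferInstanceAs (Algebra ℂ (RingQuot (ARel q)))

/-- The quotient map from the free algebra onto `O(SU_q(2))`. -/
def A.mk (q : Param) : FreeAlgebra ℂ AGen →ₐ[ℂ] A q := RingQuot.mkAlgHom ℂ (ARel q)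

lemma A.mk_rel {q : Param} {x y : FreeAlgebra ℂ AGen} (h : ARel q x y) : A.mk q x = A.mk q y :=
  RingQuot.mkAlgHom_rel ℂ h

/-- The image of a generator in `O(SU_q(2))`. -/
def A.gen (q : Param) (x : AGen) : A q := A.mk q (FreeAlgebra.ι ℂ x)

/-- The generator `a = t^{1/2}_{-1/2,-1/2}`. -/
abbrev A.a (q : Param) : A q := A.gen q AGen.a
/-- The generator `b = t^{1/2}_{-1/2,1/2}`. -/
abbrev A.b (q : Param) : A q := A.gen q AGen.b
/-- The generator `c = t^{1/2}_{1/2,-1/2}`. -/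
abbrev A.c (q : Param) : A q := A.gen q AGen.c
/-- The generator `d = t^{1/2}_{1/2,1/2}`. -/
abbrev A.d (q : Param) : A q := A.gen q AGen.d

lemma A.a_mul_b (q : Param) : A.a q * A.b q = qpow q 1 • (A.b q * A.a q) := by
  simpa [A.gen] using A.mk_rel (ARel.ab (q := q))
lemma A.a_mul_c (q : Param) : A.a q * A.c q = qpow q 1 • (A.c q * A.a q) := by
  simpa [A.gen] using A.mk_rel (ARel.ac (q := q))
lemma A.b_mul_d (q : Param) : A.b q * A.d q = qpow q 1 • (A.d q * A.b q) := by
  simpa [A.gen] using A.mk_rel (ARel.bd (q := q))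
lemma A.c_mul_d (q : Param) : A.c q * A.d q = qpow q 1 • (A.d q * A.c q) := by
  simpa [A.gen] using A.mk_rel (ARel.cd (q := q))
lemma A.b_mul_c (q : Param) : A.b q * A.c q = A.c q * A.b q := by
  simpa [A.gen] using A.mk_rel (ARel.bc (q := q))
lemma A.a_mul_d (q : Param) : A.a q * A.d q = 1 + qpow q 1 • (A.b q * A.c q) := by
  simpa [A.gen] using A.mk_rel (ARel.ad (q := q))
lemma A.d_mul_a (q : Param) : A.d q * A.a q = 1 + qpow q (-1) • (A.b q * A.c q) := by
  simpa [A.gen] using A.mk_rel (ARel.da (q := q))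

/-- The relations of `O(SU_q(2))` for a family of elements of an algebra. -/
structure A.Rels (q : Param) {B : Type*} [Ring B] [Algebra ℂ B] (x : AGen → B) : Prop where
  ab : x .a * x .b = qpow q 1 • (x .b * x .a)
  ac : x .a * x .c = qpow q 1 • (x .c * x .a)
  bd : x .b * x .d = qpow q 1 • (x .d * x .b)
  cd : x .c * x .d = qpow q 1 • (x .d * x .c)
  bc : x .b * x .c = x .c * x .b
  ad : x .a * x .d = 1 + qpow q 1 • (x .b * x .c)
  da : x .d * x .a = 1 + qpow q (-1) • (x .b * x .c)

/-- The universal property of `O(SU_q(2))`. -/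
def A.lift (q : Param) {B : Type*} [Ring B] [Algebra ℂ B] (x : AGen → B) (h : A.Rels q x) :
    A q →ₐ[ℂ] B :=
  RingQuot.liftAlgHom ℂ ⟨FreeAlgebra.lift ℂ x, by
    intro u v huv
    induction huv with
    | ab => simpa using h.ab
    | ac => simpa using h.ac
    | bd => simpa using h.bd
    | cd => simpa using h.cd
    | bc => simpa using h.bc
    | ad => simpa using h.ad
    | da => simpa using h.da⟩

@[simp] lemma A.lift_gen (q : Param) {B : Type*} [Ring B] [Algebra ℂ B] (x : AGen → B)
    (h : A.Rels q x) (g : AGen) : A.lift q x h (A.gen q g) = x g := by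
  have : A.lift q x h (A.mk q (FreeAlgebra.ι ℂ g)) = FreeAlgebra.lift ℂ x (FreeAlgebra.ι ℂ g) :=
    RingQuot.liftAlgHom_mkAlgHom_apply ..
  rw [A.gen, this, FreeAlgebra.lift_ι_apply]

lemma A.induction (q : Param) {P : A q → Prop} (hs : ∀ z : ℂ, P (algebraMap ℂ (A q) z))
    (hg : ∀ g, P (A.gen q g)) (hadd : ∀ x y, P x → P y → P (x + y))
    (hmul : ∀ x y, P x → P y → P (x * y)) (x : A q) : P x := by
  obtain ⟨y, rfl⟩ : ∃ y, A.mk q y = x := RingQuot.mkAlgHom_surjective ℂ (ARel q) x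
  induction y using FreeAlgebra.induction with
  | grade0 z => simpa using hs z
  | grade1 g => exact hg g
  | mul x y hx hy => simpa using hmul _ _ hx hy
  | add x y hx hy => simpa using hadd _ _ hx hy

/-- The counit `ε` of `O(SU_q(2))`. -/
def A.counit (q : Param) : A q →ₐ[ℂ] ℂ :=
  A.lift q (fun g => match g with | .a => 1 | .b => 0 | .c => 0 | .d => 1)
    (by constructor <;> simp)

/-! #### The involution: `a* = d`, `b* = -q c`, `c* = -q⁻¹ b`, `d* = a` -/

/-- The opposite algebra of `O(SU_q(2))` with the conjugate complex structure. -/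
def A.ConjOp (q : Param) : Type := (A q)ᵐᵒᵖ

instance (q : Param) : Ring (A.ConjOp q) := inferInstanceAs (Ring (A q)ᵐᵒᵖ)
instance (q : Param) : Algebra ℂ (A.ConjOp q) :=
  Algebra.compHom (A q)ᵐᵒᵖ (starRingEnd ℂ)

/-- The identity map from the conjugate opposite algebra. -/
def A.ConjOp.toA {q : Param} (x : A.ConjOp q) : A q := MulOpposite.unop x

/-- The identity map to the conjugate opposite algebra. -/
def A.ConjOp.ofA {q : Param} (x : A q) : A.ConjOp q := MulOpposite.op x

section
variable {q : Param}
@[simp] lemma A.ConjOp.toA_ofA (x : A q) : (A.ConjOp.ofA x).toA = x := rfl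
lemma A.ConjOp.ofA_mul (x y : A q) :
    A.ConjOp.ofA x * A.ConjOp.ofA y = A.ConjOp.ofA (y * x) := rfl
lemma A.ConjOp.ofA_add (x y : A q) :
    A.ConjOp.ofA x + A.ConjOp.ofA y = A.ConjOp.ofA (x + y) := rfl
lemma A.ConjOp.ofA_one : A.ConjOp.ofA (1 : A q) = 1 := rfl
lemma A.ConjOp.smul_ofA (z : ℂ) (x : A q) :
    z • A.ConjOp.ofA x = A.ConjOp.ofA ((starRingEnd ℂ) z • x) := rfl
lemma A.ConjOp.toA_mul (x y : A.ConjOp q) : (x * y).toA = y.toA * x.toA := rfl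
lemma A.ConjOp.toA_add (x y : A.ConjOp q) : (x + y).toA = x.toA + y.toA := rfl
lemma A.ConjOp.toA_smul (z : ℂ) (x : A.ConjOp q) :
    (z • x).toA = (starRingEnd ℂ) z • x.toA := rfl
lemma A.ConjOp.toA_one : (1 : A.ConjOp q).toA = 1 := rfl
end

/-- The images of the generators under the involution. -/
def A.starGen (q : Param) : AGen → A q
  | .a => A.d q
  | .b => -(qpow q 1 • A.c q)
  | .c => -(qpow q (-1) • A.b q)
  | .d => A.a q

/-- The involution as a homomorphism to the conjugate opposite algebra. -/
def A.starHom (q : Param) : A q →ₐ[ℂ] A.ConjOp q :=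
  A.lift q (fun g => A.ConjOp.ofA (A.starGen q g)) (by
    constructor <;>
    simp only [A.starGen, A.ConjOp.ofA_mul, A.ConjOp.smul_ofA, conj_qpow, ← A.ConjOp.ofA_one,
      A.ConjOp.ofA_add] <;> refine congrArg A.ConjOp.ofA ?_
    · simp only [neg_mul, mul_neg, smul_neg, neg_neg, smul_mul_assoc, mul_smul_comm, A.c_mul_d,
        smul_smul, ← qpow_add]
      try norm_num [qpow_zero]
    · simp only [neg_mul, mul_neg, smul_neg, neg_neg, smul_mul_assoc, mul_smul_comm, A.b_mul_d,
        smul_smul, ← qpow_add]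
      try norm_num [qpow_zero]
    · simp only [neg_mul, mul_neg, smul_neg, neg_neg, smul_mul_assoc, mul_smul_comm, A.a_mul_c,
        smul_smul, ← qpow_add]
      try norm_num [qpow_zero]
    · simp only [neg_mul, mul_neg, smul_neg, neg_neg, smul_mul_assoc, mul_smul_comm, A.a_mul_b,
        smul_smul, ← qpow_add]
      try norm_num [qpow_zero]
    · simp only [neg_mul, mul_neg, smul_neg, neg_neg, smul_mul_assoc, mul_smul_comm, A.b_mul_c,
        smul_smul, ← qpow_add]
      try norm_num [qpow_zero]
    · simp only [neg_mul, mul_neg, smul_neg, neg_neg, smul_mul_assoc, mul_smul_comm, A.a_mul_d, A.b_mul_c,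
        smul_smul, ← qpow_add]
      try norm_num [qpow_zero]
    · simp only [neg_mul, mul_neg, smul_neg, neg_neg, smul_mul_assoc, mul_smul_comm, A.d_mul_a, A.b_mul_c,
        smul_smul, ← qpow_add]
      try norm_num [qpow_zero])

instance (q : Param) : Star (A q) := ⟨fun x => (A.starHom q x).toA⟩

lemma A.star_def {q : Param} (x : A q) : star x = (A.starHom q x).toA := rfl

lemma A.star_gen (q : Param) (g : AGen) : star (A.gen q g) = A.starGen q g := by
  simp [A.star_def, A.starHom]

lemma A.star_mul' {q : Param} (x y : A q) : star (x * y) = star y * star x := by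
  simp only [A.star_def, map_mul, A.ConjOp.toA_mul]

lemma A.star_add' {q : Param} (x y : A q) : star (x + y) = star x + star y := by
  simp only [A.star_def, map_add, A.ConjOp.toA_add]

lemma A.star_smul' {q : Param} (z : ℂ) (x : A q) : star (z • x) = star z • star x := by
  simp only [A.star_def, map_smul, A.ConjOp.toA_smul]
  rfl

lemma A.star_one' (q : Param) : star (1 : A q) = 1 := by
  simp only [A.star_def, map_one, A.ConjOp.toA_one]

lemma A.star_algebraMap' {q : Param} (z : ℂ) :
    star (algebraMap ℂ (A q) z) = algebraMap ℂ (A q) (star z) := by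
  simp only [Algebra.algebraMap_eq_smul_one, A.star_smul', A.star_one']

/-- `O(SU_q(2))` is a `*`-algebra. -/
instance (q : Param) : StarRing (A q) where
  star_involutive x := by
    induction x using A.induction q with
    | hs z => simp [A.star_algebraMap']
    | hadd x y hx hy => simp [A.star_add', hx, hy]
    | hmul x y hx hy => simp [A.star_mul', hx, hy]
    | hg g =>
      cases g
      · simp [A.star_gen, A.starGen]
      · have h : -(qpow q 1 • A.c q) = (-qpow q 1) • A.c q := by simp
        rw [A.star_gen, A.starGen, h, A.star_smul', A.star_gen]
        simp [A.starGen, smul_smul, conj_qpow, qpow_mul_neg]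
      · have h : -(qpow q (-1) • A.b q) = (-qpow q (-1)) • A.b q := by simp
        rw [A.star_gen, A.starGen, h, A.star_smul', A.star_gen]
        simp [A.starGen, smul_smul, conj_qpow, qpow_neg_mul]
      · simp [A.star_gen, A.starGen]
  star_mul := A.star_mul'
  star_add := A.star_add'

instance (q : Param) : StarModule ℂ (A q) := ⟨A.star_smul'⟩

/-! #### The left action of `U_q(su_2)`

It is the module algebra structure with `E ▷ (a, b, c, d) = (b, 0, d, 0)`,
`F ▷ (a, b, c, d) = (0, a, 0, c)` and
`K ▷ (a, b, c, d) = (q^(-1/2) a, q^(1/2) b, q^(-1/2) c, q^(1/2) d)`. -/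

/-- The automorphism `K^z ▷`. -/
def A.actK (q : Param) (z : ℝ) : A q →ₐ[ℂ] A q :=
  A.lift q (fun g => match g with
    | .a => qpow q (-(z / 2)) • A.a q
    | .b => qpow q (z / 2) • A.b q
    | .c => qpow q (-(z / 2)) • A.c q
    | .d => qpow q (z / 2) • A.d q) (by
    constructor <;> simp only [smul_mul_smul_comm, ← qpow_add, add_neg_cancel, neg_add_cancel,
      qpow_zero, one_smul]
    · rw [A.a_mul_b]
    · rw [A.a_mul_c, smul_comm]
    · rw [A.b_mul_d, smul_comm]
    · rw [A.c_mul_d]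
    · rw [A.b_mul_c]
    · rw [A.a_mul_d]
    · rw [A.d_mul_a])

/-- The value of `E ▷` on the generators. -/
def A.genE (q : Param) : AGen → A q
  | .a => A.b q
  | .b => 0
  | .c => A.d q
  | .d => 0

/-- The value of `F ▷` on the generators. -/
def A.genF (q : Param) : AGen → A q
  | .a => 0
  | .b => A.a q
  | .c => 0
  | .d => A.c q

lemma A.rels_gen (q : Param) : A.Rels q (A.gen q) :=
  ⟨A.a_mul_b q, A.a_mul_c q, A.b_mul_d q, A.c_mul_d q, A.b_mul_c q, A.a_mul_d q, A.d_mul_a q⟩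

lemma A.Rels.map {q : Param} {B C : Type*} [Ring B] [Algebra ℂ B] [Ring C] [Algebra ℂ C]
    {x : AGen → B} (h : A.Rels q x) (f : B →ₐ[ℂ] C) : A.Rels q (fun g => f (x g)) := by
  constructor <;> simp only [← map_mul, ← map_smul, h.ab, h.ac, h.bd, h.cd, h.bc, h.ad, h.da]
    <;> simp

lemma A.matRels (q : Param) (D : AGen → A q)
    (hab : A.actK q (-1) (A.a q) * D .b + D .a * A.actK q 1 (A.b q)
      = qpow q 1 • (A.actK q (-1) (A.b q) * D .a + D .b * A.actK q 1 (A.a q)))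
    (hac : A.actK q (-1) (A.a q) * D .c + D .a * A.actK q 1 (A.c q)
      = qpow q 1 • (A.actK q (-1) (A.c q) * D .a + D .c * A.actK q 1 (A.a q)))
    (hbd : A.actK q (-1) (A.b q) * D .d + D .b * A.actK q 1 (A.d q)
      = qpow q 1 • (A.actK q (-1) (A.d q) * D .b + D .d * A.actK q 1 (A.b q)))
    (hcd : A.actK q (-1) (A.c q) * D .d + D .c * A.actK q 1 (A.d q)
      = qpow q 1 • (A.actK q (-1) (A.d q) * D .c + D .d * A.actK q 1 (A.c q)))
    (hbc : A.actK q (-1) (A.b q) * D .c + D .b * A.actK q 1 (A.c q)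
      = A.actK q (-1) (A.c q) * D .b + D .c * A.actK q 1 (A.b q))
    (had : A.actK q (-1) (A.a q) * D .d + D .a * A.actK q 1 (A.d q)
      = qpow q 1 • (A.actK q (-1) (A.b q) * D .c + D .b * A.actK q 1 (A.c q)))
    (hda : A.actK q (-1) (A.d q) * D .a + D .d * A.actK q 1 (A.a q)
      = qpow q (-1) • (A.actK q (-1) (A.b q) * D .c + D .b * A.actK q 1 (A.c q))) :
    A.Rels q (fun g => !![A.actK q (-1) (A.gen q g), D g; 0, A.actK q 1 (A.gen q g)]) := by
  have hm : ∀ x y z x' y' z' : A q, (!![x, y; 0, z] : Matrix (Fin 2) (Fin 2) (A q)) * !![x', y'; 0, z']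
      = !![x * x', x * y' + y * z'; 0, z * z'] := by
    intros; simp [Matrix.mul_fin_two]
  have hs : ∀ (p : ℂ) (x y z : A q), p • (!![x, y; 0, z] : Matrix (Fin 2) (Fin 2) (A q))
      = !![p • x, p • y; 0, p • z] := by
    intros; simp
  have h1 : ∀ x y z : A q, 1 + (!![x, y; 0, z] : Matrix (Fin 2) (Fin 2) (A q))
      = !![1 + x, y; 0, 1 + z] := by
    intros; simp [Matrix.one_fin_two]
  have r1 := (A.rels_gen q).map (A.actK q (-1))
  have r2 := (A.rels_gen q).map (A.actK q 1)
  constructor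
  · rw [hm, hm, hs, hab, r1.ab, r2.ab]
  · rw [hm, hm, hs, hac, r1.ac, r2.ac]
  · rw [hm, hm, hs, hbd, r1.bd, r2.bd]
  · rw [hm, hm, hs, hcd, r1.cd, r2.cd]
  · rw [hm, hm, hbc, r1.bc, r2.bc]
  · rw [hm, hm, hs, h1, had, r1.ad, r2.ad]
  · rw [hm, hm, hs, h1, hda, r1.da, r2.da]

/-- The homomorphism `x ↦ (K⁻¹ ▷ x, E ▷ x; 0, K ▷ x)`, which encodes the comultiplication
`Δ(E) = E ⊗ K + K⁻¹ ⊗ E`. -/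
def A.matE (q : Param) : A q →ₐ[ℂ] Matrix (Fin 2) (Fin 2) (A q) :=
  A.lift q (fun g => !![A.actK q (-1) (A.gen q g), A.genE q g; 0, A.actK q 1 (A.gen q g)]) (by
    apply A.matRels <;>
      simp only [A.genE, A.actK, A.lift_gen, mul_zero, zero_mul, add_zero, zero_add, smul_zero,
        smul_mul_assoc, mul_smul_comm, smul_add, A.a_mul_b, A.a_mul_c, A.b_mul_d, A.c_mul_d,
        A.b_mul_c, A.a_mul_d, A.d_mul_a, smul_smul, ← qpow_add] <;>
      norm_num [qpow_zero] <;>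
      abel)

/-- The homomorphism `x ↦ (K⁻¹ ▷ x, F ▷ x; 0, K ▷ x)`, which encodes the comultiplication
`Δ(F) = F ⊗ K + K⁻¹ ⊗ F`. -/
def A.matF (q : Param) : A q →ₐ[ℂ] Matrix (Fin 2) (Fin 2) (A q) :=
  A.lift q (fun g => !![A.actK q (-1) (A.gen q g), A.genF q g; 0, A.actK q 1 (A.gen q g)]) (by
    apply A.matRels <;>
      simp only [A.genF, A.actK, A.lift_gen, mul_zero, zero_mul, add_zero, zero_add, smul_zero,
        smul_mul_assoc, mul_smul_comm, smul_add, A.a_mul_b, A.a_mul_c, A.b_mul_d, A.c_mul_d,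
        A.b_mul_c, A.a_mul_d, A.d_mul_a, smul_smul, ← qpow_add] <;>
      norm_num [qpow_zero] <;>
      abel)

/-- The operator `E ▷`. -/
def A.actE (q : Param) : A q →ₗ[ℂ] A q :=
  Matrix.entryLinearMap ℂ (A q) 0 1 ∘ₗ (A.matE q).toLinearMap

/-- The operator `F ▷`. -/
def A.actF (q : Param) : A q →ₗ[ℂ] A q :=
  Matrix.entryLinearMap ℂ (A q) 0 1 ∘ₗ (A.matF q).toLinearMap

lemma A.matE_eq (q : Param) (x : A q) :
    A.matE q x = !![A.actK q (-1) x, A.actE q x; 0, A.actK q 1 x] := by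
  have h : ∀ x : A q, A.matE q x 0 0 = A.actK q (-1) x ∧ A.matE q x 1 0 = 0
      ∧ A.matE q x 1 1 = A.actK q 1 x := by
    intro x
    induction x using A.induction q with
    | hs z => simp [Matrix.algebraMap_matrix_apply]
    | hg g => simp [A.matE]
    | hadd x y hx hy => simp [hx, hy]
    | hmul x y hx hy => simp [hx, hy, Matrix.mul_apply, Fin.sum_univ_two]
  obtain ⟨h1, h2, h3⟩ := h x
  ext i j
  fin_cases i <;> fin_cases j <;> simp [h1, h2, h3, A.actE]

lemma A.matF_eq (q : Param) (x : A q) :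
    A.matF q x = !![A.actK q (-1) x, A.actF q x; 0, A.actK q 1 x] := by
  have h : ∀ x : A q, A.matF q x 0 0 = A.actK q (-1) x ∧ A.matF q x 1 0 = 0
      ∧ A.matF q x 1 1 = A.actK q 1 x := by
    intro x
    induction x using A.induction q with
    | hs z => simp [Matrix.algebraMap_matrix_apply]
    | hg g => simp [A.matF]
    | hadd x y hx hy => simp [hx, hy]
    | hmul x y hx hy => simp [hx, hy, Matrix.mul_apply, Fin.sum_univ_two]
  obtain ⟨h1, h2, h3⟩ := h x
  ext i j
  fin_cases i <;> fin_cases j <;> simp [h1, h2, h3, A.actF]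

lemma A.actE_mul (q : Param) (x y : A q) :
    A.actE q (x * y) = A.actE q x * A.actK q 1 y + A.actK q (-1) x * A.actE q y := by
  have h : A.matE q (x * y) 0 1 = (A.matE q x * A.matE q y) 0 1 := by rw [map_mul]
  rw [A.matE_eq, A.matE_eq q x, A.matE_eq q y, Matrix.mul_apply, Fin.sum_univ_two] at h
  simpa [add_comm] using h

lemma A.actF_mul (q : Param) (x y : A q) :
    A.actF q (x * y) = A.actF q x * A.actK q 1 y + A.actK q (-1) x * A.actF q y := by
  have h : A.matF q (x * y) 0 1 = (A.matF q x * A.matF q y) 0 1 := by rw [map_mul]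
  rw [A.matF_eq, A.matF_eq q x, A.matF_eq q y, Matrix.mul_apply, Fin.sum_univ_two] at h
  simpa [add_comm] using h

lemma A.actE_algebraMap (q : Param) (z : ℂ) : A.actE q (algebraMap ℂ (A q) z) = 0 := by
  simp [A.actE, Matrix.algebraMap_matrix_apply]

lemma A.actF_algebraMap (q : Param) (z : ℂ) : A.actF q (algebraMap ℂ (A q) z) = 0 := by
  simp [A.actF, Matrix.algebraMap_matrix_apply]

lemma A.actE_gen (q : Param) (g : AGen) : A.actE q (A.gen q g) = A.genE q g := by
  simp [A.actE, A.matE]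

lemma A.actF_gen (q : Param) (g : AGen) : A.actF q (A.gen q g) = A.genF q g := by
  simp [A.actF, A.matF]

lemma A.actK_actK (q : Param) (y z : ℝ) (x : A q) :
    A.actK q y (A.actK q z x) = A.actK q (y + z) x := by
  induction x using A.induction q with
  | hs z => simp
  | hadd x y hx hy => simp [hx, hy]
  | hmul x y hx hy => simp [hx, hy]
  | hg g =>
    cases g <;> simp only [A.actK, A.lift_gen, map_smul, smul_smul, ← qpow_add] <;>
      congr 2 <;> ring

lemma A.actK_zero (q : Param) (x : A q) : A.actK q 0 x = x := by
  induction x using A.induction q with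
  | hs z => simp
  | hadd x y hx hy => simp [hx, hy]
  | hmul x y hx hy => simp [hx, hy]
  | hg g => cases g <;> simp [A.actK, qpow_zero]

lemma A.actK_actE (q : Param) (z : ℝ) (x : A q) :
    A.actK q z (A.actE q x) = qpow q z • A.actE q (A.actK q z x) := by
  induction x using A.induction q with
  | hs z => simp [A.actE_algebraMap]
  | hadd x y hx hy => simp [hx, hy]
  | hmul x y hx hy =>
    simp only [A.actE_mul, map_mul, map_add, hx, hy, A.actK_actK, smul_add, smul_mul_assoc,
      mul_smul_comm, add_comm]
  | hg g =>
    cases g <;> simp only [A.actE_gen, A.actK, A.lift_gen, map_smul, A.genE, smul_smul,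
      ← qpow_add, map_zero, smul_zero] <;> congr 2 <;> ring

lemma A.actK_actF (q : Param) (z : ℝ) (x : A q) :
    A.actK q z (A.actF q x) = qpow q (-z) • A.actF q (A.actK q z x) := by
  induction x using A.induction q with
  | hs z => simp [A.actF_algebraMap]
  | hadd x y hx hy => simp [hx, hy]
  | hmul x y hx hy =>
    simp only [A.actF_mul, map_mul, map_add, hx, hy, A.actK_actK, smul_add, smul_mul_assoc,
      mul_smul_comm, add_comm]
  | hg g =>
    cases g <;> simp only [A.actF_gen, A.actK, A.lift_gen, map_smul, A.genF, smul_smul,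
      ← qpow_add, map_zero, smul_zero] <;> congr 2 <;> ring

lemma qpow_sub_ne (q : Param) : qpow q 1 - qpow q (-1) ≠ 0 := by
  obtain ⟨q, h0, h1⟩ := q
  simp only [qpow, Real.rpow_one, Real.rpow_neg_one]
  norm_cast
  intro h
  have h2 : q * q = 1 := by
    have : q = q⁻¹ := by linarith
    calc q * q = q * q⁻¹ := by rw [← this]
      _ = 1 := mul_inv_cancel₀ h0.ne'
  exact h1 (by nlinarith)

lemma A.actE_actF (q : Param) (x : A q) :
    A.actE q (A.actF q x) - A.actF q (A.actE q x)
      = (qpow q 1 - qpow q (-1))⁻¹ • (A.actK q 2 x - A.actK q (-2) x) := by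
  induction x using A.induction q with
  | hs z => simp [A.actF_algebraMap, A.actE_algebraMap]
  | hadd x y hx hy =>
    simp only [map_add]
    rw [add_sub_add_comm, hx, hy, ← smul_add]
    congr 1
    abel
  | hmul x y hx hy =>
    have e1 : ∀ x, A.actE q (A.actK q (-1) x) = qpow q 1 • A.actK q (-1) (A.actE q x) := by
      intro x; rw [A.actK_actE, smul_smul, qpow_mul_neg, one_smul]
    have e2 : ∀ x, A.actE q (A.actK q 1 x) = qpow q (-1) • A.actK q 1 (A.actE q x) := by
      intro x; rw [A.actK_actE, smul_smul, qpow_neg_mul, one_smul]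
    have f1 : ∀ x, A.actF q (A.actK q (-1) x) = qpow q (-1) • A.actK q (-1) (A.actF q x) := by
      intro x; rw [A.actK_actF, neg_neg, smul_smul, qpow_neg_mul, one_smul]
    have f2 : ∀ x, A.actF q (A.actK q 1 x) = qpow q 1 • A.actK q 1 (A.actF q x) := by
      intro x; rw [A.actK_actF, smul_smul, qpow_mul_neg, one_smul]
    have k1 : ∀ x, A.actK q 1 (A.actK q 1 x) = A.actK q 2 x := by
      intro x; rw [A.actK_actK]; norm_num
    have k2 : ∀ x, A.actK q (-1) (A.actK q (-1) x) = A.actK q (-2) x := by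
      intro x; rw [A.actK_actK]; norm_num
    have hx' := eq_add_of_sub_eq hx
    have hy' := eq_add_of_sub_eq hy
    simp only [A.actE_mul, A.actF_mul, map_add, map_mul, e1, e2, f1, f2, k1, k2, hx', hy',
      smul_mul_assoc, mul_smul_comm, smul_smul, qpow_mul_neg, qpow_neg_mul, add_mul, mul_add,
      sub_mul, mul_sub, smul_sub]
    module
  | hg g =>
    have h := qpow_sub_ne q
    have key : ∀ x : A q, x = (qpow q 1 - qpow q (-1))⁻¹ • (qpow q 1 • x - qpow q (-1) • x) := by
      intro x
      rw [← sub_smul, smul_smul, inv_mul_cancel₀ h, one_smul]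
    cases g <;> simp only [A.actF_gen, A.actE_gen, A.genE, A.genF, map_zero, A.actK, A.lift_gen]
    · norm_num
      rw [← neg_sub (qpow q 1 • _), smul_neg, ← key]
    · norm_num
      rw [← key]
    · norm_num
      rw [← neg_sub (qpow q 1 • _), smul_neg, ← key]
    · norm_num
      rw [← key]

/-- The left action `f ▷ x` of `U_q(su_2)` on `O(SU_q(2))`. -/
def act (q : Param) : U q →ₐ[ℂ] Module.End ℂ (A q) :=
  U.lift q (A.actE q) (A.actF q) (A.actK q 1).toLinearMap (A.actK q (-1)).toLinearMap
    (by ext x; simp [A.actK_actK, A.actK_zero])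
    (by ext x; simp [A.actK_actK, A.actK_zero])
    (by ext x; simp [A.actK_actE])
    (by ext x; simp [A.actK_actF, smul_smul, qpow_mul_neg])
    (by
      ext x
      have := A.actE_actF q x
      simp only [LinearMap.sub_apply, Module.End.mul_apply, LinearMap.smul_apply, pow_two,
        AlgHom.toLinearMap_apply, A.actK_actK, this]
      norm_num)

lemma act_E (q : Param) : act q (U.E q) = A.actE q := by simp only [act, U.lift_E]
lemma act_F (q : Param) : act q (U.F q) = A.actF q := by simp only [act, U.lift_F]
lemma act_K (q : Param) : act q (U.K q) = (A.actK q 1).toLinearMap := by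
  simp only [act, U.lift_K]
lemma act_Kinv (q : Param) : act q (U.Kinv q) = (A.actK q (-1)).toLinearMap := by
  simp only [act, U.lift_Kinv]

lemma act_K_sq (q : Param) (x : A q) : act q (U.K q ^ 2) x = A.actK q 2 x := by
  rw [map_pow, act_K, pow_two, Module.End.mul_apply, AlgHom.toLinearMap_apply,
    AlgHom.toLinearMap_apply, A.actK_actK]
  norm_num

lemma act_Kinv_sq (q : Param) (x : A q) : act q (U.Kinv q ^ 2) x = A.actK q (-2) x := by
  rw [map_pow, act_Kinv, pow_two, Module.End.mul_apply, AlgHom.toLinearMap_apply,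
    AlgHom.toLinearMap_apply, A.actK_actK]
  norm_num

/-! #### The operators `∂_f` (the right action composed with `S⁻¹`)

`∂` is the representation of `U_q(su_2)` on `O(SU_q(2))` with
`∂_X(x y) = ∂_X(x) ∂_{K⁻¹}(y) + ∂_K(x) ∂_X(y)` for `X = E, F`, with `∂_K` multiplicative, and
`∂_E (a, b, c, d) = (0, 0, -q⁻¹ a, -q⁻¹ b)`, `∂_F (a, b, c, d) = (-q c, -q d, 0, 0)`,
`∂_K (a, b, c, d) = (q^(1/2) a, q^(1/2) b, q^(-1/2) c, q^(-1/2) d)`. -/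

/-- The automorphism `∂_K^z`. -/
def A.pdK (q : Param) (z : ℝ) : A q →ₐ[ℂ] A q :=
  A.lift q (fun g => match g with
    | .a => qpow q (z / 2) • A.a q
    | .b => qpow q (z / 2) • A.b q
    | .c => qpow q (-(z / 2)) • A.c q
    | .d => qpow q (-(z / 2)) • A.d q) (by
    constructor <;> simp only [smul_mul_smul_comm, ← qpow_add, add_neg_cancel, neg_add_cancel,
      qpow_zero, one_smul]
    · rw [A.a_mul_b, smul_comm]
    · rw [A.a_mul_c]
    · rw [A.b_mul_d]
    · rw [A.c_mul_d, smul_comm]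
    · rw [A.b_mul_c]
    · rw [A.a_mul_d]
    · rw [A.d_mul_a])

/-- The transposition `b ↔ c`, an automorphism of the algebra `O(SU_q(2))`. -/
def A.transpose (q : Param) : A q →ₐ[ℂ] A q :=
  A.lift q (fun g => match g with
    | .a => A.a q | .b => A.c q | .c => A.b q | .d => A.d q)
    ⟨A.a_mul_c q, A.a_mul_b q, A.c_mul_d q, A.b_mul_d q, (A.b_mul_c q).symm,
      by rw [← A.b_mul_c]; exact A.a_mul_d q, by rw [← A.b_mul_c]; exact A.d_mul_a q⟩

lemma A.transpose_transpose (q : Param) (x : A q) : A.transpose q (A.transpose q x) = x := by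
  induction x using A.induction q with
  | hs z => simp
  | hadd x y hx hy => simp [hx, hy]
  | hmul x y hx hy => simp [hx, hy]
  | hg g => cases g <;> simp [A.transpose]

lemma A.transpose_actK (q : Param) (z : ℝ) (x : A q) :
    A.transpose q (A.actK q z x) = A.pdK q (-z) (A.transpose q x) := by
  induction x using A.induction q with
  | hs z => simp
  | hadd x y hx hy => simp [hx, hy]
  | hmul x y hx hy => simp [hx, hy]
  | hg g => cases g <;> simp [A.transpose, A.actK, A.pdK, neg_div]

/-- The operator `∂_E`. -/
def A.pdE (q : Param) : A q →ₗ[ℂ] A q :=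
  -(qpow q (-1) • ((A.transpose q).toLinearMap ∘ₗ A.actF q ∘ₗ (A.transpose q).toLinearMap))

/-- The operator `∂_F`. -/
def A.pdF (q : Param) : A q →ₗ[ℂ] A q :=
  -(qpow q 1 • ((A.transpose q).toLinearMap ∘ₗ A.actE q ∘ₗ (A.transpose q).toLinearMap))

lemma A.pdE_gen (q : Param) :
    A.pdE q (A.a q) = 0 ∧ A.pdE q (A.b q) = 0 ∧
    A.pdE q (A.c q) = -(qpow q (-1) • A.a q) ∧ A.pdE q (A.d q) = -(qpow q (-1) • A.b q) := by
  simp [A.pdE, A.transpose, A.actF_gen, A.genF]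

lemma A.pdF_gen (q : Param) :
    A.pdF q (A.a q) = -(qpow q 1 • A.c q) ∧ A.pdF q (A.b q) = -(qpow q 1 • A.d q) ∧
    A.pdF q (A.c q) = 0 ∧ A.pdF q (A.d q) = 0 := by
  simp [A.pdF, A.transpose, A.actE_gen, A.genE]

lemma A.pdE_mul (q : Param) (x y : A q) :
    A.pdE q (x * y) = A.pdE q x * A.pdK q (-1) y + A.pdK q 1 x * A.pdE q y := by
  simp only [A.pdE, LinearMap.neg_apply, LinearMap.smul_apply, LinearMap.comp_apply,
    AlgHom.toLinearMap_apply, map_mul, A.actF_mul, map_add, A.transpose_actK,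
    A.transpose_transpose, neg_neg]
  simp [smul_add, add_comm]

lemma A.pdF_mul (q : Param) (x y : A q) :
    A.pdF q (x * y) = A.pdF q x * A.pdK q (-1) y + A.pdK q 1 x * A.pdF q y := by
  simp only [A.pdF, LinearMap.neg_apply, LinearMap.smul_apply, LinearMap.comp_apply,
    AlgHom.toLinearMap_apply, map_mul, A.actE_mul, map_add, A.transpose_actK,
    A.transpose_transpose, neg_neg]
  simp [smul_add, add_comm]

lemma A.pdK_eq (q : Param) (z : ℝ) (x : A q) :
    A.pdK q z x = A.transpose q (A.actK q (-z) (A.transpose q x)) := by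
  rw [A.transpose_actK, neg_neg, A.transpose_transpose]

lemma A.pdK_pdK (q : Param) (y z : ℝ) (x : A q) :
    A.pdK q y (A.pdK q z x) = A.pdK q (y + z) x := by
  simp only [A.pdK_eq, A.transpose_transpose, A.actK_actK]
  rw [neg_add]

lemma A.pdK_zero (q : Param) (x : A q) : A.pdK q 0 x = x := by
  simp only [A.pdK_eq, neg_zero, A.actK_zero, A.transpose_transpose]

lemma A.pdK_pdE (q : Param) (z : ℝ) (x : A q) :
    A.pdK q z (A.pdE q x) = qpow q z • A.pdE q (A.pdK q z x) := by
  simp only [A.pdE, A.pdK_eq, LinearMap.neg_apply, LinearMap.smul_apply, LinearMap.comp_apply,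
    AlgHom.toLinearMap_apply, map_neg, map_smul, A.transpose_transpose, A.actK_actF, neg_neg,
    smul_neg]
  rw [smul_comm]

lemma A.pdK_pdF (q : Param) (z : ℝ) (x : A q) :
    A.pdK q z (A.pdF q x) = qpow q (-z) • A.pdF q (A.pdK q z x) := by
  simp only [A.pdF, A.pdK_eq, LinearMap.neg_apply, LinearMap.smul_apply, LinearMap.comp_apply,
    AlgHom.toLinearMap_apply, map_neg, map_smul, A.transpose_transpose, A.actK_actE, neg_neg,
    smul_neg]
  rw [smul_comm]

/-- The representation `f ↦ ∂_f` of `U_q(su_2)` on `O(SU_q(2))`. -/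
def pd (q : Param) : U q →ₐ[ℂ] Module.End ℂ (A q) :=
  U.lift q (A.pdE q) (A.pdF q) (A.pdK q 1).toLinearMap (A.pdK q (-1)).toLinearMap
    (by ext x; simp [A.pdK_pdK, A.pdK_zero])
    (by ext x; simp [A.pdK_pdK, A.pdK_zero])
    (by ext x; simp [A.pdK_pdE])
    (by ext x; simp [A.pdK_pdF, smul_smul, qpow_mul_neg])
    (by
      ext x
      have h := congrArg (A.transpose q) (A.actE_actF q (A.transpose q x))
      simp only [LinearMap.sub_apply, Module.End.mul_apply, LinearMap.smul_apply, pow_two,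
        AlgHom.toLinearMap_apply, A.pdK_pdK, A.pdE, A.pdF, LinearMap.neg_apply,
        LinearMap.comp_apply, A.transpose_transpose, map_neg, map_smul, neg_neg, smul_neg,
        smul_smul, qpow_mul_neg, qpow_neg_mul, one_smul]
      simp only [map_sub, map_smul, A.transpose_actK, A.transpose_transpose, neg_neg] at h
      rw [← neg_sub, h, ← smul_neg, neg_sub]
      norm_num)

lemma pd_F (q : Param) : pd q (U.F q) = A.pdF q := by simp only [pd, U.lift_F]

lemma pd_K_sq (q : Param) (x : A q) : pd q (U.K q ^ 2) x = A.pdK q 2 x := by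
  have h : pd q (U.K q) = (A.pdK q 1).toLinearMap := by simp only [pd, U.lift_K]
  rw [map_pow, h, pow_two, Module.End.mul_apply, AlgHom.toLinearMap_apply,
    AlgHom.toLinearMap_apply, A.pdK_pdK]
  norm_num

lemma A.pdK_star (q : Param) (z : ℝ) (x : A q) :
    A.pdK q z (star x) = star (A.pdK q (-z) x) := by
  induction x using A.induction q with
  | hs z => simp [← algebraMap_star_comm]
  | hadd x y hx hy => simp [hx, hy]
  | hmul x y hx hy => simp [hx, hy]
  | hg g =>
    cases g <;> simp only [A.star_gen, A.starGen, A.pdK, A.lift_gen, map_neg, map_smul,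
      star_smul, star_neg, smul_neg] <;>
      simp [conj_qpow, neg_div, smul_smul, mul_comm]

lemma A.pdK_actK (q : Param) (y z : ℝ) (x : A q) :
    A.pdK q y (A.actK q z x) = A.actK q z (A.pdK q y x) := by
  induction x using A.induction q with
  | hs z => simp
  | hadd x y hx hy => simp [hx, hy]
  | hmul x y hx hy => simp [hx, hy]
  | hg g => cases g <;> simp [A.pdK, A.actK, smul_smul, mul_comm]

lemma A.pdK_actE (q : Param) (y : ℝ) (x : A q) :
    A.pdK q y (A.actE q x) = A.actE q (A.pdK q y x) := by
  induction x using A.induction q with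
  | hs z => simp [A.actE_algebraMap]
  | hadd x y hx hy => simp [hx, hy]
  | hmul x y hx hy => simp [hx, hy, A.actE_mul, A.pdK_actK]
  | hg g => cases g <;> simp [A.pdK, A.actE_gen, A.genE]

/-! ### The standard Podleś sphere -/

/-- The subspace `M_N = {x : ∂_{K²}(x) = q^(-N) x}` of `O(SU_q(2))`. -/
def M (q : Param) (N : ℤ) : Submodule ℂ (A q) where
  carrier := {x | pd q (U.K q ^ 2) x = qpow q (-N) • x}
  zero_mem' := by simp
  add_mem' := by
    intro x y hx hy
    simp only [Set.mem_ofPred_eq] at *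
    rw [map_add, hx, hy, smul_add]
  smul_mem' := by
    intro z x hx
    simp only [Set.mem_ofPred_eq] at *
    rw [map_smul, hx, smul_comm]

lemma mem_M (q : Param) (N : ℤ) (x : A q) : x ∈ M q N ↔ A.pdK q 2 x = qpow q (-N) • x := by
  rw [← pd_K_sq]
  rfl

/-- The standard Podleś sphere `O(S_q^2) = M_0`, as a subalgebra of `O(SU_q(2))`. -/
def S2 (q : Param) : Subalgebra ℂ (A q) where
  carrier := M q 0
  mul_mem' := by
    intro x y hx hy
    simp only [SetLike.mem_coe, mem_M, Int.cast_zero, neg_zero, qpow_zero, one_smul] at *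
    rw [map_mul, hx, hy]
  add_mem' := (M q 0).add_mem
  algebraMap_mem' := by
    intro z
    simp [mem_M, qpow_zero]

lemma mem_S2 (q : Param) (x : A q) : x ∈ S2 q ↔ A.pdK q 2 x = x := by
  have h : x ∈ S2 q ↔ x ∈ M q 0 := Iff.rfl
  simp [h, mem_M, qpow_zero]

/-- The modular automorphism `θ(y) = K⁻² ▷ y` of the Haar state of the Podleś sphere. -/
def theta (q : Param) : S2 q ≃ₐ[ℂ] S2 q where
  toFun y := ⟨act q (U.Kinv q ^ 2) y, by
    have := (mem_S2 q _).1 y.2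
    rw [mem_S2, act_Kinv_sq, A.pdK_actK, this]⟩
  invFun y := ⟨act q (U.K q ^ 2) y, by
    have := (mem_S2 q _).1 y.2
    rw [mem_S2, act_K_sq, A.pdK_actK, this]⟩
  left_inv y := by
    ext
    simp [-map_pow, act_K_sq, act_Kinv_sq, A.actK_actK, A.actK_zero]
  right_inv y := by
    ext
    simp [-map_pow, act_K_sq, act_Kinv_sq, A.actK_actK, A.actK_zero]
  map_mul' x y := by
    ext
    simp [-map_pow, act_Kinv_sq]
  map_add' x y := by
    ext
    simp [-map_pow]
  commutes' z := by
    ext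
    simp [-map_pow, act_Kinv_sq]

/-- The counit of `O(SU_q(2))`, restricted to the Podleś sphere. -/
def counit (q : Param) : S2 q →ₐ[ℂ] ℂ := (A.counit q).comp (S2 q).val

/-! ### Matrix elements and the projections `P_N` -/

/-- The vector `v^l_{jk}` with `l = m / 2`, `j = r - m / 2`, `k = s - m / 2`, `0 ≤ r, s ≤ m`.
It is obtained from `v^l_{-l,-l} = [2l+1]_q^(1/2) q^(-l) a^(2l)` by
`∂_F(v^l_{jk}) = -α^l_j v^l_{j+1,k}` and `E ▷ v^l_{jk} = α^l_k v^l_{j,k+1}`. -/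
def v (q : Param) (m : ℕ) : ℕ → ℕ → A q
  | 0, 0 => ((Real.sqrt (qnum q (m + 1)) : ℂ) * qpow q (-(m / 2 : ℝ))) • A.a q ^ m
  | 0, s + 1 => (alpha q m s : ℂ)⁻¹ • act q (U.E q) (v q m 0 s)
  | r + 1, s => -((alpha q m r : ℂ)⁻¹ • pd q (U.F q) (v q m r s))

/-- The matrix element `t^l_{jk}` of the spin-`l` corepresentation, defined by
`v^l_{jk} = [2l+1]_q^(1/2) q^j t^l_{jk}`, with `l = m / 2`, `j = r - m / 2`, `k = s - m / 2`. -/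
def t (q : Param) (m r s : ℕ) : A q :=
  ((Real.sqrt (qnum q (m + 1)) : ℂ) * qpow q ((r : ℝ) - m / 2))⁻¹ • v q m r s

lemma pdK_v (q : Param) (m r s : ℕ) :
    A.pdK q 2 (v q m r s) = qpow q ((m : ℝ) - 2 * r) • v q m r s := by
  induction r with
  | zero =>
    induction s with
    | zero =>
      have h : ∀ n : ℕ, A.pdK q 2 (A.a q ^ n) = qpow q n • A.a q ^ n := by
        intro n
        induction n with
        | zero => simp [qpow_zero]
        | succ n ih =>
          rw [pow_succ, map_mul, ih]
          simp [A.pdK, ← qpow_add, smul_smul, add_comm]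
      simp only [v, map_smul, h]
      rw [smul_comm]
      simp
    | succ s ih =>
      simp only [v, map_smul, act_E, A.pdK_actE, ih]
      rw [smul_comm]
  | succ r ih =>
    simp only [v, map_neg, map_smul, pd_F, A.pdK_pdF, ih, smul_smul, smul_neg, ← mul_assoc,
      ← qpow_add]
    congr 2
    rw [mul_comm]
    congr 2
    push_cast
    ring

lemma star_t_mul_t_mem (q : Param) (m r i j : ℕ) : star (t q m r i) * t q m r j ∈ S2 q := by
  have h : ∀ s, A.pdK q 2 (t q m r s) = qpow q ((m : ℝ) - 2 * r) • t q m r s := by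
    intro s
    simp only [t, map_smul, pdK_v]
    rw [smul_comm]
  have h' : A.pdK q (-2) (t q m r i) = qpow q (-((m : ℝ) - 2 * r)) • t q m r i := by
    have e := congrArg (A.pdK q (-2)) (h i)
    rw [A.pdK_pdK, neg_add_cancel, A.pdK_zero, map_smul] at e
    rw [e, smul_smul, ← e, qpow_neg_mul, one_smul]
  rw [mem_S2, map_mul, h, A.pdK_star, h', star_smul]
  simp [-neg_sub, conj_qpow, smul_smul, qpow_mul_neg]

/-- The matrix `P_N = ρ°_l(K⁻¹) t_n^{l*} t_n^l ρ°_l(K)`, `n = N / 2`, `l = |N| / 2`, with entries in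
`O(SU_q(2))`. Here `t_n^l = (t^l_{n,-l}, …, t^l_{n,l})` is a row vector. The index of the row
`n = N / 2` is `n + l = (N + |N|) / 2 = max N 0`. -/
def projA (q : Param) (N : ℤ) : Matrix (Fin (N.natAbs + 1)) (Fin (N.natAbs + 1)) (A q) :=
  (rho q N.natAbs (U.Kinv q)).map (algebraMap ℂ (A q))
    * Matrix.vecMulVec (fun i : Fin (N.natAbs + 1) => star (t q N.natAbs N.toNat i))
        (fun j : Fin (N.natAbs + 1) => t q N.natAbs N.toNat j)
    * (rho q N.natAbs (U.K q)).map (algebraMap ℂ (A q))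

lemma projA_mem (q : Param) (N : ℤ) (i j : Fin (N.natAbs + 1)) : projA q N i j ∈ S2 q := by
  rw [projA, Matrix.mul_apply]
  refine Subalgebra.sum_mem _ fun k _ => Subalgebra.mul_mem _ ?_ (Subalgebra.algebraMap_mem _ _)
  rw [Matrix.mul_apply]
  exact Subalgebra.sum_mem _ fun k _ => Subalgebra.mul_mem _ (Subalgebra.algebraMap_mem _ _)
    (star_t_mul_t_mem ..)

/-- The matrix `P_N` over the Podleś sphere. -/
def proj (q : Param) (N : ℤ) : Matrix (Fin (N.natAbs + 1)) (Fin (N.natAbs + 1)) (S2 q) :=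
  fun i j => ⟨projA q N i j, projA_mem q N i j⟩

/-- The scalar matrix `ε(P_N)`, the counit being applied to each entry. -/
def counitProj (q : Param) (N : ℤ) : Matrix (Fin (N.natAbs + 1)) (Fin (N.natAbs + 1)) (S2 q) :=
  (proj q N).map fun x => algebraMap ℂ (S2 q) (counit q x)

/-! ### Twisted Hochschild cycles and the quantum trace -/

section Hochschild

variable {B : Type*} [Ring B] [Algebra ℂ B]

/-- The face `d_{2,0} : x ⊗ y ⊗ z ↦ x y ⊗ z`. -/
def d20 : B ⊗[ℂ] B ⊗[ℂ] B →ₗ[ℂ] B ⊗[ℂ] B :=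
  TensorProduct.map (LinearMap.mul' ℂ B) LinearMap.id

/-- The face `d_{2,1} : x ⊗ y ⊗ z ↦ x ⊗ y z`. -/
def d21 : B ⊗[ℂ] B ⊗[ℂ] B →ₗ[ℂ] B ⊗[ℂ] B :=
  TensorProduct.map LinearMap.id (LinearMap.mul' ℂ B) ∘ₗ
    (TensorProduct.assoc ℂ B B B).toLinearMap

/-- The twisted face `d_{2,2}^lam : x ⊗ y ⊗ z ↦ lam(z) x ⊗ y`. -/
def d22 (lam : B ≃ₐ[ℂ] B) : B ⊗[ℂ] B ⊗[ℂ] B →ₗ[ℂ] B ⊗[ℂ] B :=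
  TensorProduct.map (LinearMap.mul' ℂ B ∘ₗ TensorProduct.map lam.toLinearMap LinearMap.id)
      LinearMap.id ∘ₗ
    (TensorProduct.assoc ℂ B B B).symm.toLinearMap ∘ₗ
    (TensorProduct.comm ℂ (B ⊗[ℂ] B) B).toLinearMap

/-- The twisted Hochschild boundary `b_2^lam = d_{2,0} - d_{2,1} + d_{2,2}^lam`. -/
def b2 (lam : B ≃ₐ[ℂ] B) : B ⊗[ℂ] B ⊗[ℂ] B →ₗ[ℂ] B ⊗[ℂ] B := d20 - d21 + d22 lam

lemma b2_tmul (lam : B ≃ₐ[ℂ] B) (x y z : B) :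
    b2 lam (x ⊗ₜ[ℂ] y ⊗ₜ[ℂ] z)
      = (x * y) ⊗ₜ[ℂ] z - x ⊗ₜ[ℂ] (y * z) + (lam z * x) ⊗ₜ[ℂ] y := by
  simp [b2, d20, d21, d22]

/-- A `lam`-twisted Hochschild 2-cycle. -/
def IsTwistedHochschildTwoCycle (lam : B ≃ₐ[ℂ] B) (eta : B ⊗[ℂ] B ⊗[ℂ] B) : Prop :=
  b2 lam eta = 0

/-- The quantum trace of `X ⊗ Y ⊗ Z` with weight matrix `R`:
`∑ R_{j₃ j₀} X_{j₀ j₁} ⊗ Y_{j₁ j₂} ⊗ Z_{j₂ j₃}`. If `lam(b) = k ▷ b`, then `Tr_lam` is the quantum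
trace with weight `R = ρ°(k)`. -/
def qTrace {n : Type*} [Fintype n] (R : Matrix n n ℂ) :
    Matrix n n B ⊗[ℂ] Matrix n n B ⊗[ℂ] Matrix n n B →ₗ[ℂ] B ⊗[ℂ] B ⊗[ℂ] B :=
  ∑ j₀, ∑ j₁, ∑ j₂, ∑ j₃, R j₃ j₀ •
    TensorProduct.map
      (TensorProduct.map (Matrix.entryLinearMap ℂ B j₀ j₁) (Matrix.entryLinearMap ℂ B j₁ j₂))
      (Matrix.entryLinearMap ℂ B j₂ j₃)

lemma qTrace_tmul {n : Type*} [Fintype n] (R : Matrix n n ℂ) (X Y Z : Matrix n n B) :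
    qTrace R (X ⊗ₜ[ℂ] Y ⊗ₜ[ℂ] Z)
      = ∑ j₀, ∑ j₁, ∑ j₂, ∑ j₃, R j₃ j₀ • (X j₀ j₁ ⊗ₜ[ℂ] Y j₁ j₂ ⊗ₜ[ℂ] Z j₂ j₃) := by
  simp [qTrace]

end Hochschild

/-- The modified Chern character
`Tr_{θ⁻¹}((1 - 2 P_N) ⊗ (P_N - ε(P_N)) ⊗ (P_N - ε(P_N)))`; here `θ⁻¹(y) = K² ▷ y`, so that
`Tr_{θ⁻¹}` is the quantum trace with weight `ρ°_{|N|/2}(K²)`. -/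
def chBar (q : Param) (N : ℤ) : S2 q ⊗[ℂ] S2 q ⊗[ℂ] S2 q :=
  qTrace (rho q N.natAbs (U.K q ^ 2))
    ((1 - 2 * proj q N) ⊗ₜ[ℂ] (proj q N - counitProj q N) ⊗ₜ[ℂ] (proj q N - counitProj q N))

end Podles

end

/-! Write `R = diag(r)` for the weight of the quantum trace, `e` for the scalar matrix `ε(P)`, and
`⟨X, Y⟩ = ∑ r i • (X i j ⊗ Y j i)`. If `lam` is `θ⁻¹` and `r j • lam (Z i j) = r i • Z i j`, the
twist in the last face only moves the weight to the other index, and the boundary of the trace of `X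
⊗ Y ⊗ Z` becomes `⟨XY, Z⟩ - ⟨X, YZ⟩ + ⟨ZX, Y⟩` (`b2_qTrace_tmul`). Scalar matrices pass through the
middle of the pairing, and also around the outside if they commute with `R`.

For `X = 1 - 2P` and `Y = Z = P - e`, with `P` and `e` idempotent, everything cancels except `⟨1, e⟩
- ⟨1, P⟩ = 1 ⊗ ∑ r i • (e i i - P i i)`. This vanishes as soon as the twisted trace of `P` is a
scalar, since a scalar equals its own counit (`isTwistedHochschildTwoCycle_of_idempotent`).

Three facts about `P_N` remain. Covariance under `θ⁻¹` holds because the `t^l_{nk}` are weight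
vectors for `K ▷`. That `ε(P_N)` commutes with `R` follows by applying `ε`, which is `θ⁻¹`-invariant
on the sphere. Idempotency and scalar twisted trace require the sums `∑ t t* = 1` and `∑ q^(-2k) t*
t` along the row `n = N / 2`. As `l = |N| / 2`, this is an extreme row, so with `(x, y) = (c, d)` or
`(a, b)` and `m = |N|` its entries are monomials `w_s x^(m-s) y^s`, where `w_s²` is the Gaussian
binomial at `q^(-2)` (`t_eq_weightCoeff`, `weightCoeff_sq`). Both sums are then noncommutative
binomial expansions, evaluated by induction on `m` from the case of spin `1/2`
(`sum_gaussBinom_mul_star`, `sum_gaussBinom_star_mul`). -/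

open scoped TensorProduct

noncomputable section

namespace Podles

/-! ### Twisted traces of idempotent matrices over an arbitrary algebra. -/

section TwistedTrace

variable {B : Type*} [Ring B] [Algebra ℂ B] {n : Type*} [Fintype n]

/-- The twisted trace pairing `∑ r i • (X i j ⊗ Y j i)` of two matrices. -/
def tracePairing (r : n → ℂ) : Matrix n n B →ₗ[ℂ] Matrix n n B →ₗ[ℂ] B ⊗[ℂ] B :=
  ∑ i, ∑ j, r i • (TensorProduct.mk ℂ B B).compl₁₂
    (Matrix.entryLinearMap ℂ B i j) (Matrix.entryLinearMap ℂ B j i)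

lemma tracePairing_apply (r : n → ℂ) (X Y : Matrix n n B) :
    tracePairing r X Y = ∑ i, ∑ j, r i • (X i j ⊗ₜ[ℂ] Y j i) := by
  simp [tracePairing, LinearMap.sum_apply]

/-- The hypothesis on `Z` is its covariance: it trades `lam` for a move of the weight from the
column index of `Z` to its row index, which is where cyclic rotation needs it. The twisted boundary
thereby reduces to matrix products. -/
lemma b2_qTrace_tmul [DecidableEq n] (lam : B ≃ₐ[ℂ] B) (r : n → ℂ) (X Y Z : Matrix n n B)
    (hZ : ∀ i j, r j • lam (Z i j) = r i • Z i j) :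
    b2 lam (qTrace (Matrix.diagonal r) (X ⊗ₜ[ℂ] Y ⊗ₜ[ℂ] Z))
      = tracePairing r (X * Y) Z - tracePairing r X (Y * Z) + tracePairing r (Z * X) Y := by
  have h0 : qTrace (Matrix.diagonal r) (X ⊗ₜ[ℂ] Y ⊗ₜ[ℂ] Z)
      = ∑ i, ∑ j, ∑ k, r i • (X i j ⊗ₜ[ℂ] Y j k ⊗ₜ[ℂ] Z k i) := by
    rw [qTrace_tmul]
    refine Finset.sum_congr rfl fun i _ => Finset.sum_congr rfl fun j _ =>
      Finset.sum_congr rfl fun k _ => ?_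
    rw [Finset.sum_eq_single i]
    · rw [Matrix.diagonal_apply_eq]
    · intro l _ hl
      rw [Matrix.diagonal_apply_ne _ hl, zero_smul]
    · simp
  have h1 : tracePairing r (X * Y) Z
      = ∑ i, ∑ j, ∑ k, r i • ((X i j * Y j k) ⊗ₜ[ℂ] Z k i) := by
    rw [tracePairing_apply]
    refine Finset.sum_congr rfl fun i _ => ?_
    rw [Finset.sum_comm]
    refine Finset.sum_congr rfl fun k _ => ?_
    rw [Matrix.mul_apply, TensorProduct.sum_tmul, Finset.smul_sum]
  have h2 : tracePairing r X (Y * Z)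
      = ∑ i, ∑ j, ∑ k, r i • (X i j ⊗ₜ[ℂ] (Y j k * Z k i)) := by
    rw [tracePairing_apply]
    refine Finset.sum_congr rfl fun i _ => Finset.sum_congr rfl fun j _ => ?_
    rw [Matrix.mul_apply, TensorProduct.tmul_sum, Finset.smul_sum]
  have h3 : tracePairing r (Z * X) Y
      = ∑ i, ∑ j, ∑ k, r k • ((Z k i * X i j) ⊗ₜ[ℂ] Y j k) := by
    have : tracePairing r (Z * X) Y
        = ∑ k, ∑ i, ∑ j, r k • ((Z k i * X i j) ⊗ₜ[ℂ] Y j k) := by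
      rw [tracePairing_apply]
      refine Finset.sum_congr rfl fun k _ => ?_
      rw [Finset.sum_comm]
      refine Finset.sum_congr rfl fun j _ => ?_
      rw [Matrix.mul_apply, TensorProduct.sum_tmul, Finset.smul_sum]
    rw [this, Finset.sum_comm]
    refine Finset.sum_congr rfl fun i _ => ?_
    rw [Finset.sum_comm]
  rw [h0, h1, h2, h3]
  simp only [map_sum, map_smul, b2_tmul, ← Finset.sum_sub_distrib, ← Finset.sum_add_distrib]
  refine Finset.sum_congr rfl fun i _ => Finset.sum_congr rfl fun j _ =>
    Finset.sum_congr rfl fun k _ => ?_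
  rw [smul_add, smul_sub]
  congr 1
  -- Only the third face is left: `r i • lam (Z k i) = r k • Z k i`.
  rw [TensorProduct.smul_tmul', TensorProduct.smul_tmul', ← smul_mul_assoc, ← smul_mul_assoc, hZ]

/-- The tensor product is over `ℂ`, so scalar entries cross it freely; no compatibility with the
weights is needed. -/
lemma tracePairing_mul_scalar (r : n → ℂ) (e : Matrix n n ℂ) (X Y : Matrix n n B) :
    tracePairing r (X * e.map (algebraMap ℂ B)) Y
      = tracePairing r X (e.map (algebraMap ℂ B) * Y) := by
  simp only [tracePairing_apply, Matrix.mul_apply, Matrix.map_apply, TensorProduct.sum_tmul,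
    TensorProduct.tmul_sum, Finset.smul_sum]
  refine Finset.sum_congr rfl fun i _ => ?_
  rw [Finset.sum_comm]
  refine Finset.sum_congr rfl fun j _ => Finset.sum_congr rfl fun k _ => ?_
  rw [← Algebra.commutes, ← Algebra.smul_def, ← Algebra.smul_def, TensorProduct.smul_tmul]

/-- Moving a scalar matrix around the outside of the trace passes it through `diagonal r`; the
hypothesis `he` says that it commutes with that matrix. -/
lemma tracePairing_scalar_mul (r : n → ℂ) (e : Matrix n n ℂ)
    (he : ∀ i j, r j * e i j = r i * e i j) (X Y : Matrix n n B) :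
    tracePairing r (e.map (algebraMap ℂ B) * X) Y
      = tracePairing r X (Y * e.map (algebraMap ℂ B)) := by
  simp only [tracePairing_apply, Matrix.mul_apply, Matrix.map_apply, TensorProduct.sum_tmul,
    TensorProduct.tmul_sum, Finset.smul_sum]
  calc _ = ∑ i, ∑ k, ∑ j, r i • (((algebraMap ℂ B) (e i k) * X k j) ⊗ₜ[ℂ] Y j i) :=
        Finset.sum_congr rfl fun i _ => Finset.sum_comm
    _ = ∑ k, ∑ i, ∑ j, r i • (((algebraMap ℂ B) (e i k) * X k j) ⊗ₜ[ℂ] Y j i) :=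
        Finset.sum_comm
    _ = _ := by
      refine Finset.sum_congr rfl fun k _ => ?_
      rw [Finset.sum_comm]
      refine Finset.sum_congr rfl fun j _ => Finset.sum_congr rfl fun i _ => ?_
      rw [← Algebra.commutes, ← Algebra.smul_def, ← Algebra.smul_def, TensorProduct.tmul_smul,
        ← TensorProduct.smul_tmul', smul_smul, smul_smul, he]

lemma tracePairing_one [DecidableEq n] (r : n → ℂ) (Y : Matrix n n B) :
    tracePairing r 1 Y = 1 ⊗ₜ[ℂ] ∑ i, r i • Y i i := by
  rw [tracePairing_apply, TensorProduct.tmul_sum]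
  refine Finset.sum_congr rfl fun i _ => ?_
  rw [Finset.sum_eq_single i]
  · rw [Matrix.one_apply_eq, TensorProduct.tmul_smul]
  · intro j _ hj
    rw [Matrix.one_apply_ne hj.symm, TensorProduct.zero_tmul, smul_zero]
  · simp

/-- The modified Chern character of an idempotent matrix is a twisted Hochschild 2-cycle if the
idempotent is covariant, has scalar twisted trace, and `e` is its image under a character. -/
lemma isTwistedHochschildTwoCycle_of_idempotent [DecidableEq n] (lam : B ≃ₐ[ℂ] B) (r : n → ℂ)
    (P : Matrix n n B) (ε : B →ₐ[ℂ] ℂ) (hP : P * P = P)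
    (hlam : ∀ i j, r j • lam (P i j) = r i • P i j)
    (hε : ∀ i j, r j * ε (P i j) = r i * ε (P i j))
    (c : ℂ) (htr : ∑ i, r i • P i i = algebraMap ℂ B c) :
    IsTwistedHochschildTwoCycle lam (qTrace (Matrix.diagonal r)
      ((1 - 2 * P) ⊗ₜ[ℂ] (P - P.map fun x => algebraMap ℂ B (ε x))
        ⊗ₜ[ℂ] (P - P.map fun x => algebraMap ℂ B (ε x)))) := by
  set e₀ : Matrix n n ℂ := P.map ε with he₀
  have he : (P.map fun x => algebraMap ℂ B (ε x)) = e₀.map (algebraMap ℂ B) := by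
    ext i j; simp [he₀]
  have hee₀ : e₀ * e₀ = e₀ := by
    have h := congrArg (fun X : Matrix n n B => X.map ε) hP
    simpa [Matrix.map_mul] using h
  rw [he]
  have hR := tracePairing_mul_scalar (B := B) r e₀
  have hL := tracePairing_scalar_mul (B := B) r e₀ (fun i j => by simpa [he₀] using hε i j)
  have hee : e₀.map (algebraMap ℂ B) * e₀.map (algebraMap ℂ B) = e₀.map (algebraMap ℂ B) := by
    rw [← Matrix.map_mul, hee₀]
  -- The twisted trace of `P` is the scalar `c`, and `ε` fixes scalars, so the twisted trace of
  -- `ε(P)` is `c` as well.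
  have h1 : tracePairing r 1 P = tracePairing r 1 (e₀.map (algebraMap ℂ B)) := by
    rw [tracePairing_one, tracePairing_one, htr]
    have h := congrArg ε htr
    simp only [map_sum, map_smul, AlgHom.commutes] at h
    have h' := congrArg (algebraMap ℂ B) h
    simp only [Algebra.algebraMap_self, RingHom.id_apply] at h'
    rw [← h', map_sum]
    simp [he₀, Algebra.smul_def]
  set e := e₀.map (algebraMap ℂ B)
  rw [IsTwistedHochschildTwoCycle, b2_qTrace_tmul]
  · have h2 : (2 : Matrix n n B) = 1 + 1 := by norm_num
    have hPe : tracePairing r 1 (P * e) = tracePairing r 1 (e * P) := by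
      rw [← hL, ← hR, one_mul, mul_one]
    have heY : ∀ Y, tracePairing r e Y = tracePairing r 1 (e * Y) := fun Y => by
      rw [← hR, one_mul]
    -- The rewrites bring every scalar factor into the second slot. Before `h1`, what survives the
    -- cancellation is `⟨1, e⟩ - ⟨1, P⟩`.
    simp only [h2, add_mul, one_mul, mul_sub, sub_mul, mul_add, mul_one, hP, hee, map_add, map_sub,
      LinearMap.add_apply, LinearMap.sub_apply, hR, hL, heY, hPe, h1]
    abel
  · intro i j
    have h := hε i j
    have h3 : e i j = algebraMap ℂ B (ε (P i j)) := by simp [e, he₀]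
    rw [Matrix.sub_apply, map_sub, smul_sub, smul_sub, hlam, h3, AlgEquiv.commutes]
    congr 1
    rw [Algebra.smul_def, Algebra.smul_def, ← map_mul, ← map_mul, h]

end TwistedTrace

/-! ### Gaussian binomials and binomial sums in q-commuting elements. -/

section GaussianBinomial

/-- The Gaussian binomial coefficient `(m choose s)_p`. -/
def gaussBinom (p : ℂ) : ℕ → ℕ → ℂ
  | _, 0 => 1
  | 0, _ + 1 => 0
  | m + 1, s + 1 => p ^ (s + 1) * gaussBinom p m (s + 1) + gaussBinom p m s

lemma gaussBinom_zero_right (p : ℂ) (m : ℕ) : gaussBinom p m 0 = 1 := by cases m <;> rfl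

lemma gaussBinom_succ_succ (p : ℂ) (m s : ℕ) : gaussBinom p (m + 1) (s + 1)
    = p ^ (s + 1) * gaussBinom p m (s + 1) + gaussBinom p m s := rfl

lemma gaussBinom_eq_zero (p : ℂ) {m s : ℕ} (h : m < s) : gaussBinom p m s = 0 := by
  induction m generalizing s with
  | zero => obtain ⟨s, rfl⟩ := Nat.exists_eq_succ_of_ne_zero h.ne'; rfl
  | succ m ih =>
    obtain ⟨s, rfl⟩ := Nat.exists_eq_succ_of_ne_zero (Nat.ne_zero_of_lt h)
    rw [gaussBinom_succ_succ, ih (by omega), ih (by omega), mul_zero, add_zero]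

lemma gaussBinom_self (p : ℂ) (m : ℕ) : gaussBinom p m m = 1 := by
  induction m with
  | zero => rfl
  | succ m ih => rw [gaussBinom_succ_succ, gaussBinom_eq_zero p m.lt_succ_self, ih]; simp

/-- This is the quotient of neighbouring binomials, cross-multiplied so that it holds for every `p`,
roots of unity included. It yields the second Pascal rule and the recursion for the squared
normalizations. -/
lemma gaussBinom_ratio (p : ℂ) (s k : ℕ) :
    gaussBinom p (s + k) (s + 1) * (1 - p ^ (s + 1)) = gaussBinom p (s + k) s * (1 - p ^ k) := by
  -- The induction runs on the upper index `s + k`, with `s` and `k` both varying.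
  obtain ⟨m, hm⟩ : ∃ m, m = s + k := ⟨_, rfl⟩
  rw [← hm]
  induction m generalizing s k with
  | zero =>
    obtain ⟨rfl, rfl⟩ : s = 0 ∧ k = 0 := by omega
    simp [gaussBinom_eq_zero]
  | succ m ih =>
    rcases k with _ | k
    · rw [gaussBinom_eq_zero p (by omega)]; simp
    rcases s with _ | s
    · have h := ih 0 k (by omega)
      rw [gaussBinom_succ_succ]
      simp only [gaussBinom_zero_right] at h ⊢
      linear_combination p * h
    · have h1 := ih (s + 1) k (by omega)
      have h2 := ih s (k + 1) (by omega)
      rw [gaussBinom_succ_succ, gaussBinom_succ_succ]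
      linear_combination p ^ (s + 2) * h1 + h2

lemma gaussBinom_succ_succ' (p : ℂ) {m s : ℕ} (h : s ≤ m) :
    gaussBinom p (m + 1) (s + 1) = gaussBinom p m (s + 1) + p ^ (m - s) * gaussBinom p m s := by
  obtain ⟨k, rfl⟩ := Nat.exists_eq_add_of_le h
  rw [gaussBinom_succ_succ, Nat.add_sub_cancel_left]
  linear_combination -gaussBinom_ratio p s k

variable {V : Type*} [AddCommGroup V] [Module ℂ V]

lemma sum_gaussBinom_succ (p : ℂ) (m : ℕ) (f : ℕ → V) :
    ∑ s ∈ Finset.range (m + 2), gaussBinom p (m + 1) s • f s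
      = ∑ s ∈ Finset.range (m + 1), gaussBinom p m s • (p ^ s • f s + f (s + 1)) := by
  -- The added term `s = m + 1` is zero. With it, splitting off `s = 0` turns the Pascal terms of
  -- lower index `s + 1` into a full sum.
  have h : ∑ s ∈ Finset.range (m + 2), (p ^ s * gaussBinom p m s) • f s
      = ∑ s ∈ Finset.range (m + 1), (p ^ s * gaussBinom p m s) • f s := by
    rw [Finset.sum_range_succ, gaussBinom_eq_zero p m.lt_succ_self, mul_zero, zero_smul, add_zero]
  rw [Finset.sum_range_succ'] at h ⊢
  simp only [gaussBinom_zero_right, pow_zero, mul_one] at h ⊢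
  simp only [gaussBinom_succ_succ, add_smul, Finset.sum_add_distrib, smul_add, smul_smul]
  rw [add_right_comm, h]
  simp only [mul_comm]

lemma sum_gaussBinom_succ' (p : ℂ) (m : ℕ) (f : ℕ → V) :
    ∑ s ∈ Finset.range (m + 2), gaussBinom p (m + 1) s • f s
      = ∑ s ∈ Finset.range (m + 1), gaussBinom p m s • (f s + p ^ (m - s) • f (s + 1)) := by
  have h : ∑ s ∈ Finset.range (m + 2), gaussBinom p m s • f s
      = ∑ s ∈ Finset.range (m + 1), gaussBinom p m s • f s := by
    rw [Finset.sum_range_succ, gaussBinom_eq_zero p m.lt_succ_self, zero_smul, add_zero]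
  rw [Finset.sum_range_succ'] at h ⊢
  have h' : ∑ s ∈ Finset.range (m + 1), gaussBinom p (m + 1) (s + 1) • f (s + 1)
      = ∑ s ∈ Finset.range (m + 1), (gaussBinom p m (s + 1) • f (s + 1)
        + gaussBinom p m s • p ^ (m - s) • f (s + 1)) := by
    refine Finset.sum_congr rfl fun s hs => ?_
    rw [gaussBinom_succ_succ' p (Nat.lt_succ_iff.1 (Finset.mem_range.1 hs)), add_smul,
      smul_smul, mul_comm (gaussBinom p m s)]
  rw [h', Finset.sum_add_distrib]
  simp only [smul_add, Finset.sum_add_distrib]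
  rw [← h]
  simp only [gaussBinom_zero_right]
  abel

variable {B : Type*} [Ring B] [Algebra ℂ B] {Q : ℂ} {x y x' y' : B}

lemma pow_mul_of_qcomm (h : x * y = Q • (y * x)) (k : ℕ) : x ^ k * y = Q ^ k • (y * x ^ k) := by
  induction k with
  | zero => simp
  | succ k ih =>
    rw [pow_succ, mul_assoc, h, mul_smul_comm, ← mul_assoc, ih, smul_mul_assoc, smul_smul,
      mul_assoc, ← pow_succ, ← pow_succ']

lemma mul_pow_of_qcomm (h : x * y = Q • (y * x)) (k : ℕ) : x * y ^ k = Q ^ k • (y ^ k * x) := by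
  induction k with
  | zero => simp
  | succ k ih =>
    rw [pow_succ, ← mul_assoc, ih, smul_mul_assoc, mul_assoc, h, mul_smul_comm, smul_smul,
      ← mul_assoc, ← pow_succ]

/-- Passing from `m` to `m + 1` wraps the sum as `x (·) x' + y (·) y'`. The outer `y` and `y'` must
cross `x^(m-s)` and `x'^(m-s)`, which costs `Q^(2(m-s))`; the factor `p^(m-s)` of the second Pascal
rule cancels exactly this. -/
lemma sum_gaussBinom_mul_star {p : ℂ} (hpQ : p * (Q * Q) = 1)
    (h : x * y = Q • (y * x)) (h' : y' * x' = Q • (x' * y')) (h1 : x * x' + y * y' = 1) (m : ℕ) :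
    ∑ s ∈ Finset.range (m + 1),
      gaussBinom p m s • (x ^ (m - s) * y ^ s * (y' ^ s * x' ^ (m - s))) = 1 := by
  induction m with
  | zero => simp [gaussBinom_zero_right]
  | succ m ih =>
    rw [sum_gaussBinom_succ' p]
    calc _ = ∑ s ∈ Finset.range (m + 1), gaussBinom p m s •
          (x * (x ^ (m - s) * y ^ s * (y' ^ s * x' ^ (m - s))) * x'
            + y * (x ^ (m - s) * y ^ s * (y' ^ s * x' ^ (m - s))) * y') := by
          refine Finset.sum_congr rfl fun s hs => ?_
          congr 2
          · rw [Nat.sub_add_comm (Nat.lt_succ_iff.1 (Finset.mem_range.1 hs)), pow_succ' x,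
              pow_succ x']
            simp only [mul_assoc]
          · have e1 := pow_mul_of_qcomm h (m - s)
            have e2 := mul_pow_of_qcomm h' (m - s)
            rw [Nat.add_sub_add_right, pow_succ' y, pow_succ y']
            calc _ = p ^ (m - s) •
                  ((x ^ (m - s) * y) * y ^ s * (y' ^ s * (y' * x' ^ (m - s)))) := by
                  simp only [mul_assoc]
              _ = _ := by
                  rw [e1, e2]
                  simp only [smul_mul_assoc, mul_smul_comm, smul_smul]
                  rw [← mul_pow, ← mul_pow, hpQ, one_pow, one_smul]
                  simp only [mul_assoc]
      _ = x * 1 * x' + y * 1 * y' := by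
          rw [← ih]
          simp only [Finset.mul_sum, Finset.sum_mul, smul_add, Finset.sum_add_distrib,
            mul_smul_comm, smul_mul_assoc]
      _ = 1 := by rw [mul_one, mul_one, h1]

/-- In this order `y` and `y'` are outermost already, and `x`, `x'` must cross `y^s`, `y'^s`, so the
first Pascal rule with its `p^s` applies. For `Q = q`, `p = q^(-2)` the weight `Q^m p^s` is `q^(-2(s
- m/2))`. Its growth by `Q` or by `Q p = Q⁻¹` gives the two coefficients in `h1`, and the inner sum,
being scalar by induction, can be pulled out of the sandwich. -/
lemma sum_gaussBinom_star_mul {p : ℂ} {lam : ℂ} (hpQ : p * (Q * Q) = 1)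
    (h : x * y = Q • (y * x)) (h' : y' * x' = Q • (x' * y'))
    (h1 : Q • (x' * x) + Q⁻¹ • (y' * y) = algebraMap ℂ B lam) (m : ℕ) :
    ∑ s ∈ Finset.range (m + 1),
      gaussBinom p m s • (Q ^ m * p ^ s) • (y' ^ s * x' ^ (m - s) * (x ^ (m - s) * y ^ s))
      = algebraMap ℂ B (lam ^ m) := by
  induction m with
  | zero => simp [gaussBinom_zero_right]
  | succ m ih =>
    have hQ : Q ≠ 0 := by rintro rfl; simp at hpQ
    rw [sum_gaussBinom_succ]
    calc _ = ∑ s ∈ Finset.range (m + 1), gaussBinom p m s • (Q ^ m * p ^ s) •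
          (Q • (x' * (y' ^ s * x' ^ (m - s) * (x ^ (m - s) * y ^ s)) * x)
            + Q⁻¹ • (y' * (y' ^ s * x' ^ (m - s) * (x ^ (m - s) * y ^ s)) * y)) := by
          refine Finset.sum_congr rfl fun s hs => ?_
          congr 1
          rw [smul_add]
          congr 1
          · have e1 := mul_pow_of_qcomm h s
            have e2 := pow_mul_of_qcomm h' s
            rw [Nat.sub_add_comm (Nat.lt_succ_iff.1 (Finset.mem_range.1 hs)), pow_succ x,
              pow_succ' x']
            calc _ = p ^ s • (Q ^ (m + 1) * p ^ s) •
                  ((y' ^ s * x') * x' ^ (m - s) * (x ^ (m - s) * (x * y ^ s))) := by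
                  simp only [mul_assoc]
              _ = _ := by
                  rw [e1, e2]
                  simp only [smul_mul_assoc, mul_smul_comm, smul_smul]
                  congr 1
                  · have e3 : p ^ s * (Q ^ s * Q ^ s) = 1 := by
                      rw [← mul_pow, ← mul_pow, hpQ, one_pow]
                    rw [pow_succ]
                    linear_combination Q ^ m * Q * p ^ s * e3
                  · simp only [mul_assoc]
          · rw [Nat.add_sub_add_right, pow_succ' y', pow_succ y, smul_smul]
            congr 1
            · field_simp
              rw [pow_succ, pow_succ]
              linear_combination Q ^ m * p ^ s * hpQ
            · simp only [mul_assoc]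
      _ = Q • (x' * algebraMap ℂ B (lam ^ m) * x) + Q⁻¹ • (y' * algebraMap ℂ B (lam ^ m) * y) := by
          rw [← ih]
          simp only [Finset.mul_sum, Finset.sum_mul, smul_add, Finset.sum_add_distrib,
            mul_smul_comm, smul_mul_assoc, Finset.smul_sum]
          congr 1 <;> refine Finset.sum_congr rfl fun s _ => ?_ <;> module
      _ = algebraMap ℂ B (lam ^ (m + 1)) := by
          rw [← Algebra.commutes, ← Algebra.commutes, mul_assoc, mul_assoc, pow_succ, map_mul,
            ← h1, mul_add, mul_smul_comm, mul_smul_comm]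

end GaussianBinomial

/-! ### q-numbers and the normalization of weight vectors. -/

lemma qpow_nat_mul (q : Param) (n : ℕ) (x : ℝ) : qpow q (n * x) = qpow q x ^ n := by
  rw [qpow, qpow, mul_comm, Real.rpow_mul q.2.1.le, Real.rpow_natCast, Complex.ofReal_pow]

lemma qnum_pos (q : Param) {x : ℝ} (hx : 0 < x) : 0 < qnum q x := by
  obtain ⟨q, h0, h1⟩ := q
  unfold qnum
  rcases lt_or_gt_of_ne h1 with h | h
  · apply div_pos_of_neg_of_neg
    · have := Real.rpow_lt_rpow_of_exponent_gt h0 h (show -x < x by linarith)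
      simpa using this
    · have := (one_lt_inv₀ h0).2 h
      simp only; linarith
  · apply div_pos
    · have := Real.rpow_lt_rpow_of_exponent_lt h (show -x < x by linarith)
      simpa using this
    · have := inv_lt_one_of_one_lt₀ h
      simp only; linarith

lemma alpha_pos (q : Param) {m s : ℕ} (h : s < m) : 0 < alpha q m s :=
  Real.sqrt_pos.2 (mul_pos (qnum_pos q (by simpa using h)) (qnum_pos q (by positivity)))

lemma qpow_sub_mul_qnum (q : Param) (x : ℝ) :
    (qpow q 1 - qpow q (-1)) * (qnum q x : ℂ) = qpow q x - qpow q (-x) := by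
  have h := qpow_sub_ne q
  have h2 : (qnum q x : ℂ) = (qpow q x - qpow q (-x)) / (qpow q 1 - qpow q (-1)) := by
    simp [qnum, qpow, Real.rpow_neg_one]
  rw [h2, mul_div_cancel₀ _ h]

lemma qnum_succ (q : Param) (x : ℝ) :
    (qnum q (x + 1) : ℂ) = qpow q (-1) * qnum q x + qpow q x := by
  refine mul_left_cancel₀ (qpow_sub_ne q) ?_
  have h1 := qpow_sub_mul_qnum q (x + 1)
  have h2 := qpow_sub_mul_qnum q x
  have h3 : qpow q (x + 1) = qpow q x * qpow q 1 := qpow_add q x 1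
  have h4 : qpow q (-(x + 1)) = qpow q (-x) * qpow q (-1) := by
    rw [← qpow_add]; congr 1; ring
  rw [h1, h3, h4]
  linear_combination -qpow q (-1) * h2

/-- The coefficient of `x^(m-s) y^s` in the normalized weight vector obtained from `x^m` by
applying `E` repeatedly `s` times. -/
def weightCoeff (q : Param) (m : ℕ) : ℕ → ℝ
  | 0 => 1
  | s + 1 => (alpha q m s)⁻¹ * (q.1 ^ ((s : ℝ) / 2 - ((m : ℝ) - s - 1) / 2)
      * qnum q ((m : ℝ) - s)) * weightCoeff q m s

lemma weightCoeff_pos (q : Param) {m s : ℕ} (h : s ≤ m) : 0 < weightCoeff q m s := by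
  induction s with
  | zero => exact one_pos
  | succ s ih =>
    have h1 : (s : ℝ) < m := by exact_mod_cast h
    exact mul_pos (mul_pos (inv_pos.2 (alpha_pos q h)) (mul_pos (Real.rpow_pos_of_pos q.2.1 _)
      (qnum_pos q (by linarith)))) (ih (by omega))

/-- With `k = m - s`, squaring one recursion step multiplies by `q^(s+1-k) [k] / [s+1]`, because
`α²` cancels one factor `[k]`. That is `(1 - p^k) / (1 - p^(s+1))` for `p = q^(-2)`, the ratio of
consecutive Gaussian binomials. -/
lemma weightCoeff_sq (q : Param) {m s : ℕ} (h : s ≤ m) :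
    (weightCoeff q m s : ℂ) * weightCoeff q m s = gaussBinom (qpow q (-2)) m s := by
  induction s with
  | zero => simp [weightCoeff, gaussBinom_zero_right]
  | succ s ih =>
    have hα : (alpha q m s : ℂ) ≠ 0 := by exact_mod_cast (alpha_pos q h).ne'
    have hs : (qnum q ((s : ℝ) + 1) : ℂ) ≠ 0 := by
      exact_mod_cast (qnum_pos q (show (0 : ℝ) < s + 1 by positivity)).ne'
    have hα2 := alpha_sq q (m := m) (s := s) (by omega)
    push_cast at hα2
    obtain ⟨k, rfl⟩ := Nat.exists_eq_add_of_le (show s ≤ m by omega)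
    have hr := gaussBinom_ratio (qpow q (-2)) s k
    rw [← ih (by omega)] at hr
    -- This translates the factors `1 - p^n` into q-numbers.
    have p1 : ∀ n : ℕ, 1 - qpow q (-2) ^ n
        = qpow q (-n) * ((qpow q 1 - qpow q (-1)) * qnum q n) := by
      intro n
      rw [qpow_sub_mul_qnum, mul_sub, qpow_neg_mul, ← qpow_add, ← qpow_nat_mul]
      congr 2; ring
    rw [p1, p1] at hr
    have e0 : ((s + k : ℕ) : ℝ) - s = k := by push_cast; ring
    have hw : (weightCoeff q (s + k) (s + 1) : ℂ) = (alpha q (s + k) s : ℂ)⁻¹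
      * (qpow q ((s : ℝ) / 2 - ((k : ℝ) - 1) / 2) * qnum q k) * weightCoeff q (s + k) s := by
      rw [weightCoeff, e0]
      simp [qpow]
    rw [e0] at hα2
    have hq : qpow q ((s : ℝ) / 2 - ((k : ℝ) - 1) / 2) * qpow q ((s : ℝ) / 2 - ((k : ℝ) - 1) / 2)
        = qpow q (((s + 1 : ℕ) : ℝ)) * qpow q (-k) := by
      rw [← qpow_add, ← qpow_add]; congr 1; push_cast; ring
    have hk : (qnum q k : ℂ) ≠ 0 := by
      exact_mod_cast (qnum_pos q (show (0 : ℝ) < k by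
        have : 0 < k := by omega
        exact_mod_cast this)).ne'
    have hD := qpow_sub_ne q
    have hs' := qpow_neg_mul q ((s + 1 : ℕ) : ℝ)
    rw [hw]
    have e1 : (qnum q ((s + 1 : ℕ) : ℝ) : ℂ) = qnum q ((s : ℝ) + 1) := by push_cast; rfl
    rw [e1] at hr
    set W : ℂ := (weightCoeff q (s + k) s : ℂ)
    set G := gaussBinom (qpow q (-2)) (s + k) (s + 1)
    set α : ℂ := (alpha q (s + k) s : ℂ)
    set X := qpow q ((s : ℝ) / 2 - ((k : ℝ) - 1) / 2)
    set Y := qpow q ((s + 1 : ℕ) : ℝ)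
    set Y' := qpow q (-((s + 1 : ℕ) : ℝ))
    set Z := qpow q (-(k : ℝ))
    set D := qpow q 1 - qpow q (-1)
    set u := (qnum q ((s : ℝ) + 1) : ℂ)
    set w := (qnum q k : ℂ)
    have hG : G * u = W * W * Y * Z * w := by
      refine mul_left_cancel₀ hD ?_
      linear_combination Y * hr - D * G * u * hs'
    have : α⁻¹ * (X * w) * W * (α⁻¹ * (X * w) * W) = (X * X) * w ^ 2 * W ^ 2 / (α * α) := by
      field_simp
    rw [this, hα2, hq]
    field_simp
    linear_combination -hG

/-- Positivity selects the root `1` of the square, so that the corner `t^l_{l,-l}` comes out as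
exactly `c^(2l)`. -/
lemma weightCoeff_self (q : Param) (m : ℕ) : weightCoeff q m m = 1 := by
  have h := weightCoeff_sq q (le_refl m)
  rw [gaussBinom_self] at h
  have h2 : weightCoeff q m m * weightCoeff q m m = 1 := by exact_mod_cast h
  nlinarith [weightCoeff_pos q (le_refl m)]

/-! ### Spin-1/2 pairs and the action of `E` on their monomials. -/

/-- A pair of elements spanning a copy of the spin-`1/2` representation under `▷`, with the
commutation relation of the quantum plane. -/
structure IsSpinHalfPair (q : Param) (x y : A q) : Prop where
  comm : x * y = qpow q 1 • (y * x)
  actE_left : A.actE q x = y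
  actE_right : A.actE q y = 0
  actK_left : ∀ z, A.actK q z x = qpow q (-(z / 2)) • x
  actK_right : ∀ z, A.actK q z y = qpow q (z / 2) • y

lemma isSpinHalfPair_a_b (q : Param) : IsSpinHalfPair q (A.a q) (A.b q) :=
  ⟨A.a_mul_b q, A.actE_gen .., A.actE_gen .., fun _ => by simp [A.actK],
    fun _ => by simp [A.actK]⟩

lemma isSpinHalfPair_c_d (q : Param) : IsSpinHalfPair q (A.c q) (A.d q) :=
  ⟨A.c_mul_d q, A.actE_gen .., A.actE_gen .., fun _ => by simp [A.actK],
    fun _ => by simp [A.actK]⟩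

namespace IsSpinHalfPair

variable {q : Param} {x y : A q}

lemma actK_pow_mul_pow (h : IsSpinHalfPair q x y) (z : ℝ) (k s : ℕ) :
    A.actK q z (x ^ k * y ^ s) = qpow q (z * (((s : ℝ) - k) / 2)) • (x ^ k * y ^ s) := by
  rw [map_mul, map_pow, map_pow, h.actK_left, h.actK_right, smul_pow, smul_pow,
    smul_mul_smul_comm, ← qpow_nat_mul, ← qpow_nat_mul, ← qpow_add]
  congr 2; ring

lemma actE_pow_right (h : IsSpinHalfPair q x y) (s : ℕ) : A.actE q (y ^ s) = 0 := by
  induction s with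
  | zero => simpa using A.actE_algebraMap q 1
  | succ s ih => rw [pow_succ, A.actE_mul, ih, h.actE_right, zero_mul, mul_zero, add_zero]

lemma actE_pow_left (h : IsSpinHalfPair q x y) (k : ℕ) :
    A.actE q (x ^ (k + 1)) = (qpow q (-(k / 2)) * qnum q (k + 1)) • (x ^ k * y) := by
  induction k with
  | zero =>
    have h1 : (qnum q 1 : ℂ) = 1 := by
      have := qnum_succ q 0
      simpa [qnum_zero, qpow_zero] using this
    simp [h.actE_left, qpow_zero, h1]
  | succ k ih =>
    have h1 := h.actK_pow_mul_pow (-1) (k + 1) 0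
    rw [pow_zero, mul_one] at h1
    have h2 : y * x = qpow q (-1) • (x * y) := by
      rw [h.comm, smul_smul, qpow_neg_mul, one_smul]
    rw [pow_succ, A.actE_mul, ih, h1, h.actK_left, h.actE_left, smul_mul_smul_comm,
      mul_assoc (x ^ k), h2, mul_smul_comm, ← mul_assoc, ← pow_succ, smul_mul_assoc, smul_smul,
      ← add_smul]
    congr 1
    -- The two Leibniz terms add up by `[k+2] = q⁻¹ [k+1] + q^(k+1)`.
    have h3 := qnum_succ q ((k : ℝ) + 1)
    push_cast
    rw [h3]
    have h4 : qpow q (-1 * (((0 : ℝ) - (k + 1)) / 2))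
        = qpow q (-((k + 1) / 2)) * qpow q (k + 1) := by
      rw [← qpow_add]; congr 1; ring
    have h5 : qpow q (-((k + 1 : ℝ) / 2)) = qpow q (-((k : ℝ) / 2)) * qpow q (-(1 / 2)) := by
      rw [← qpow_add]; congr 1; ring
    rw [h4, h5]
    ring

lemma actE_pow_mul_pow (h : IsSpinHalfPair q x y) (k s : ℕ) :
    A.actE q (x ^ (k + 1) * y ^ s)
      = (qpow q (s / 2 - k / 2) * qnum q (k + 1)) • (x ^ k * y ^ (s + 1)) := by
  have h1 := h.actK_pow_mul_pow 1 0 s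
  rw [pow_zero, one_mul] at h1
  rw [A.actE_mul, h.actE_pow_right, mul_zero, add_zero, h.actE_pow_left, h1, smul_mul_smul_comm,
    mul_assoc (x ^ k), ← pow_succ', mul_right_comm, ← qpow_add]
  congr 3
  push_cast
  ring

/-- Normalized weight vectors are related by `E`. -/
lemma actE_weightCoeff (h : IsSpinHalfPair q x y) {m s : ℕ} (hs : s < m) :
    (alpha q m s : ℂ)⁻¹ • A.actE q ((weightCoeff q m s : ℂ) • (x ^ (m - s) * y ^ s))
      = (weightCoeff q m (s + 1) : ℂ) • (x ^ (m - (s + 1)) * y ^ (s + 1)) := by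
  obtain ⟨k, rfl⟩ := Nat.exists_eq_add_of_lt hs
  have e1 : s + k + 1 - s = k + 1 := by omega
  have e2 : s + k + 1 - (s + 1) = k := by omega
  rw [e1, e2, map_smul, h.actE_pow_mul_pow, smul_smul, smul_smul]
  congr 1
  have e3 : ((s + k + 1 : ℕ) : ℝ) - s = k + 1 := by push_cast; ring
  rw [weightCoeff, e3]
  have e4 : (s : ℝ) / 2 - (k + 1 - 1) / 2 = s / 2 - k / 2 := by ring
  rw [e4]
  simp only [Complex.ofReal_mul, Complex.ofReal_inv, qpow]
  ring

end IsSpinHalfPair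

/-! ### Matrix elements in the first column and in the extreme rows. -/

lemma A.pdF_weightCoeff (q : Param) {m r : ℕ} (hr : r < m) :
    -((alpha q m r : ℂ)⁻¹ • A.pdF q ((weightCoeff q m r : ℂ) • (A.a q ^ (m - r) * A.c q ^ r)))
      = (qpow q 1 * weightCoeff q m (r + 1) : ℂ) • (A.a q ^ (m - (r + 1)) * A.c q ^ (r + 1)) := by
  have hT : ∀ k s : ℕ, A.transpose q (A.a q ^ k * A.c q ^ s) = A.a q ^ k * A.b q ^ s := by
    intro k s; simp [A.transpose]
  have hT' : ∀ k s : ℕ, A.transpose q (A.a q ^ k * A.b q ^ s) = A.a q ^ k * A.c q ^ s := by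
    intro k s; simp [A.transpose]
  -- The transposition `b ↔ c` conjugates `E ▷` into `∂_F` up to the factor `-q`, so climbing from
  -- `a` to `b` becomes descending from `a` to `c`.
  have h := congrArg (A.transpose q) ((isSpinHalfPair_a_b q).actE_weightCoeff hr)
  simp only [map_smul, hT'] at h
  simp only [A.pdF, LinearMap.neg_apply, LinearMap.smul_apply, LinearMap.comp_apply,
    AlgHom.toLinearMap_apply, map_smul, hT, smul_neg, neg_neg]
  rw [mul_smul, ← h]
  module

lemma A.pdF_algebraMap (q : Param) (z : ℂ) : A.pdF q (algebraMap ℂ (A q) z) = 0 := by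
  simp [A.pdF, A.actE_algebraMap]

lemma A.pdF_actK (q : Param) (z : ℝ) (x : A q) :
    A.pdF q (A.actK q z x) = A.actK q z (A.pdF q x) := by
  induction x using A.induction q with
  | hs z => simp [A.pdF_algebraMap]
  | hadd x y hx hy => simp [hx, hy]
  | hmul x y hx hy => simp [hx, hy, A.pdF_mul, A.pdK_actK]
  | hg g =>
    obtain ⟨h1, h2, h3, h4⟩ := A.pdF_gen q
    cases g <;> simp [A.actK, h1, h2, h3, h4, smul_smul, mul_comm]

lemma A.pdF_actE (q : Param) (x : A q) : A.pdF q (A.actE q x) = A.actE q (A.pdF q x) := by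
  induction x using A.induction q with
  | hs z => simp [A.pdF_algebraMap, A.actE_algebraMap]
  | hadd x y hx hy => simp [hx, hy]
  | hmul x y hx hy =>
    simp only [A.actE_mul, A.pdF_mul, map_add, hx, hy, A.pdF_actK, A.pdK_actK, A.pdK_actE]
    abel
  | hg g =>
    obtain ⟨h1, h2, h3, h4⟩ := A.pdF_gen q
    cases g <;> simp [A.actE_gen, A.genE, h1, h2, h3, h4]

/-- The definition uses `E` in row `0` only; the relation spreads to all rows because `∂_F` commutes
with `E ▷`. -/
lemma v_succ_right (q : Param) (m r s : ℕ) :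
    v q m r (s + 1) = (alpha q m s : ℂ)⁻¹ • A.actE q (v q m r s) := by
  induction r with
  | zero => rw [v, act_E]
  | succ r ih =>
    rw [v, v, ih, pd_F, map_smul, map_neg, map_smul, A.pdF_actE, smul_comm, smul_neg]

lemma t_succ_right (q : Param) (m r s : ℕ) :
    t q m r (s + 1) = (alpha q m s : ℂ)⁻¹ • A.actE q (t q m r s) := by
  rw [t, t, v_succ_right, map_smul, smul_comm]

/-- The factor `q⁻¹` comes from the normalization `q^j` of `v^l_{jk}`; it cancels the `q` produced
by `∂_F` on powers of `a` and `c`. -/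
lemma t_succ_left (q : Param) (m r s : ℕ) :
    t q m (r + 1) s = qpow q (-1) • -((alpha q m r : ℂ)⁻¹ • A.pdF q (t q m r s)) := by
  have h : qpow q ((r + 1 : ℕ) - m / 2) = qpow q (r - m / 2) * qpow q 1 := by
    rw [← qpow_add]; congr 1; push_cast; ring
  have h1 : qpow q (-1) = (qpow q 1)⁻¹ := eq_inv_of_mul_eq_one_left (qpow_neg_mul q 1)
  rw [t, t, v, pd_F, h, map_smul, ← mul_assoc, mul_inv _ (qpow q 1), h1]
  module

lemma t_zero_zero (q : Param) (m : ℕ) : t q m 0 0 = A.a q ^ m := by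
  have h : (Real.sqrt (qnum q (m + 1)) : ℂ) ≠ 0 := by
    exact_mod_cast (Real.sqrt_pos.2 (qnum_pos q (by positivity))).ne'
  rw [t, v, smul_smul, inv_mul_eq_div, Nat.cast_zero, zero_sub, div_self
    (mul_ne_zero h (qpow_ne q _)), one_smul]

/-- A row is generated from its first entry by `E`. If that entry is a pure power `x^m`, as in the
two extreme rows, the whole row consists of monomials. -/
lemma t_eq_weightCoeff {q : Param} {m r : ℕ} {x y : A q} (h : IsSpinHalfPair q x y)
    (h0 : t q m r 0 = x ^ m) {s : ℕ} (hs : s ≤ m) :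
    t q m r s = (weightCoeff q m s : ℂ) • (x ^ (m - s) * y ^ s) := by
  induction s with
  | zero => simp [h0, weightCoeff]
  | succ s ih => rw [t_succ_right, ih (by omega), h.actE_weightCoeff hs]

lemma t_left_zero (q : Param) {m r : ℕ} (hr : r ≤ m) :
    t q m r 0 = (weightCoeff q m r : ℂ) • (A.a q ^ (m - r) * A.c q ^ r) := by
  induction r with
  | zero => simp [t_zero_zero, weightCoeff]
  | succ r ih =>
    rw [t_succ_left, ih (by omega), A.pdF_weightCoeff q hr, smul_smul, ← mul_assoc, qpow_neg_mul,
      one_mul]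

lemma t_self_zero (q : Param) (m : ℕ) : t q m m 0 = A.c q ^ m := by
  rw [t_left_zero q le_rfl, weightCoeff_self]
  simp

/-! ### Norm, twisted norm and weights of an extreme row. -/

section Row

variable {q : Param} {m r : ℕ} {x y : A q}

lemma qpow_neg_two_mul (q : Param) : qpow q (-2) * (qpow q 1 * qpow q 1) = 1 := by
  rw [← qpow_add, ← qpow_add]; norm_num [qpow_zero]

lemma star_comm_of_isSpinHalfPair (h : IsSpinHalfPair q x y) :
    star y * star x = qpow q 1 • (star x * star y) := by
  have h1 := congrArg star h.comm
  rwa [star_mul, star_smul, star_mul, show star (qpow q 1) = qpow q 1 from conj_qpow q 1] at h1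

lemma star_ofReal_smul (c : ℝ) (X : A q) : star ((c : ℂ) • X) = (c : ℂ) • star X := by
  rw [star_smul]
  congr 1
  exact Complex.conj_ofReal c

lemma sum_t_mul_star_t (h : IsSpinHalfPair q x y) (h0 : t q m r 0 = x ^ m)
    (h1 : x * star x + y * star y = 1) :
    ∑ s : Fin (m + 1), t q m r s * star (t q m r s) = 1 := by
  rw [Fin.sum_univ_eq_sum_range (fun s => t q m r s * star (t q m r s)),
    ← sum_gaussBinom_mul_star (qpow_neg_two_mul q) h.comm (star_comm_of_isSpinHalfPair h) h1 m]
  refine Finset.sum_congr rfl fun s hs => ?_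
  have hs' := Nat.lt_succ_iff.1 (Finset.mem_range.1 hs)
  rw [t_eq_weightCoeff h h0 hs', star_ofReal_smul, smul_mul_smul_comm, weightCoeff_sq q hs',
    star_mul, star_pow, star_pow]

lemma sum_star_t_mul_t (h : IsSpinHalfPair q x y) (h0 : t q m r 0 = x ^ m) {lam : ℂ}
    (h1 : qpow q 1 • (star x * x) + (qpow q 1)⁻¹ • (star y * y) = algebraMap ℂ (A q) lam) :
    ∑ s : Fin (m + 1), qpow q (-2 * ((s : ℝ) - m / 2)) • (star (t q m r s) * t q m r s)
      = algebraMap ℂ (A q) (lam ^ m) := by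
  rw [Fin.sum_univ_eq_sum_range
      (fun s : ℕ => qpow q (-2 * ((s : ℝ) - m / 2)) • (star (t q m r s) * t q m r s)),
    ← sum_gaussBinom_star_mul (qpow_neg_two_mul q) h.comm (star_comm_of_isSpinHalfPair h) h1 m]
  refine Finset.sum_congr rfl fun s hs => ?_
  have hs' := Nat.lt_succ_iff.1 (Finset.mem_range.1 hs)
  rw [t_eq_weightCoeff h h0 hs', star_ofReal_smul, smul_mul_smul_comm, weightCoeff_sq q hs',
    star_mul, star_pow, star_pow, smul_comm, ← qpow_nat_mul, ← qpow_nat_mul, ← qpow_add]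
  congr 3
  ring

lemma actK_t (h : IsSpinHalfPair q x y) (h0 : t q m r 0 = x ^ m) (z : ℝ) {s : ℕ} (hs : s ≤ m) :
    A.actK q z (t q m r s) = qpow q (z * ((s : ℝ) - m / 2)) • t q m r s := by
  rw [t_eq_weightCoeff h h0 hs, map_smul, h.actK_pow_mul_pow, smul_comm]
  congr 2
  rw [Nat.cast_sub hs]
  ring

end Row

/-- The row index `max N 0` is the last one, `|N|`, for `N ≥ 0` and the first one, `0`, for `N < 0`.
The pair is accordingly `(c, d)` with `lam = q⁻¹` or `(a, b)` with `lam = q`; the two quadratic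
identities are the relations for `ad` and `da`. -/
lemma exists_isSpinHalfPair_t (q : Param) (N : ℤ) : ∃ (x y : A q) (lam : ℂ),
    IsSpinHalfPair q x y ∧ t q N.natAbs N.toNat 0 = x ^ N.natAbs ∧ x * star x + y * star y = 1 ∧
      qpow q 1 • (star x * x) + (qpow q 1)⁻¹ • (star y * y) = algebraMap ℂ (A q) lam := by
  have hq : (qpow q 1)⁻¹ = qpow q (-1) := (eq_inv_of_mul_eq_one_left (qpow_neg_mul q 1)).symm
  rcases le_or_gt 0 N with hN | hN
  · refine ⟨A.c q, A.d q, qpow q (-1), isSpinHalfPair_c_d q, ?_, ?_, ?_⟩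
    · rw [show N.toNat = N.natAbs by omega, t_self_zero]
    · simp [A.star_gen, A.starGen, A.d_mul_a, A.b_mul_c]
    · simp [A.star_gen, A.starGen, A.a_mul_d, hq, smul_smul, qpow_mul_neg, qpow_neg_mul,
        Algebra.algebraMap_eq_smul_one]
  · refine ⟨A.a q, A.b q, qpow q 1, isSpinHalfPair_a_b q, ?_, ?_, ?_⟩
    · rw [show N.toNat = 0 by omega, t_zero_zero]
    · simp [A.star_gen, A.starGen, A.a_mul_d]
    · simp [A.star_gen, A.starGen, A.d_mul_a, A.b_mul_c, hq, smul_smul, qpow_mul_neg,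
        qpow_neg_mul, Algebra.algebraMap_eq_smul_one]

/-! ### The matrices `P_N`: idempotency, covariance and twisted trace. -/

lemma sigma_K (q : Param) (m : ℕ) : sigma q m (U.K q) = spinK q m 1 := by
  simp only [sigma, U.lift_K]

lemma sigma_Kinv (q : Param) (m : ℕ) : sigma q m (U.Kinv q) = spinK q m (-1) := by
  simp only [sigma, U.lift_Kinv]

lemma antipode_K (q : Param) : (U.antipode q (U.K q)).unop = U.Kinv q := by
  simp only [U.antipode, U.lift_K, MulOpposite.unop_op]

lemma antipode_Kinv (q : Param) : (U.antipode q (U.Kinv q)).unop = U.K q := by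
  simp only [U.antipode, U.lift_Kinv, MulOpposite.unop_op]

lemma rho_K (q : Param) (m : ℕ) : rho q m (U.K q) = spinK q m (-1) := by
  rw [rho, antipode_K, mul_assoc, U.Kinv_mul_K, mul_one, sigma_Kinv]

lemma rho_Kinv (q : Param) (m : ℕ) : rho q m (U.Kinv q) = spinK q m 1 := by
  rw [rho, antipode_Kinv, U.Kinv_mul_K, one_mul, sigma_K]

/-- Conjugation by `K` does nothing to powers of `K`, so only the inversion by the antipode remains:
the trace weights are `q^(-2k)`. -/
lemma rho_K_sq (q : Param) (m : ℕ) : rho q m (U.K q ^ 2) = spinK q m (-2) := by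
  rw [rho, map_pow, MulOpposite.unop_pow, antipode_K, pow_two, mul_assoc, mul_assoc,
    U.Kinv_mul_K, mul_one, map_mul, sigma_Kinv, spinK_mul]
  norm_num

lemma projA_apply (q : Param) (N : ℤ) (i j : Fin (N.natAbs + 1)) :
    projA q N i j = qpow q ((i : ℝ) - j) •
      (star (t q N.natAbs N.toNat i) * t q N.natAbs N.toNat j) := by
  have hd : ∀ z, (spinK q N.natAbs z).map (algebraMap ℂ (A q)) = Matrix.diagonal
      fun i : Fin (N.natAbs + 1) => algebraMap ℂ (A q) (qpow q (z * ((i : ℝ) - N.natAbs / 2))) := by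
    intro z
    rw [spinK, Matrix.diagonal_map (map_zero _)]
  rw [projA, rho_K, rho_Kinv, hd, hd, Matrix.mul_diagonal, Matrix.diagonal_mul,
    Matrix.vecMulVec_apply, ← Algebra.commutes, ← Algebra.smul_def, ← Algebra.smul_def, smul_smul,
    ← qpow_add]
  congr 2
  ring

lemma proj_mul_proj (q : Param) (N : ℤ) : proj q N * proj q N = proj q N := by
  obtain ⟨x, y, lam, h, h0, h1, -⟩ := exists_isSpinHalfPair_t q N
  ext i j
  have hs : ((proj q N * proj q N) i j : A q) = ∑ k, projA q N i k * projA q N k j := by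
    rw [Matrix.mul_apply, AddSubmonoidClass.coe_finsetSum]
    rfl
  rw [hs]
  change _ = projA q N i j
  calc _ = ∑ k : Fin (N.natAbs + 1), qpow q ((i : ℝ) - j) • (star (t q N.natAbs N.toNat i) *
        (t q N.natAbs N.toNat k * star (t q N.natAbs N.toNat k)) * t q N.natAbs N.toNat j) := by
        refine Finset.sum_congr rfl fun k _ => ?_
        rw [projA_apply, projA_apply, smul_mul_smul_comm, ← qpow_add]
        simp only [mul_assoc]
        congr 2
        ring
    _ = _ := by
        -- The inner product `t_n t_n^*` of the row with itself is `1`, and the powers of `q`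
        -- telescope.
        rw [← Finset.smul_sum, ← Finset.sum_mul, ← Finset.mul_sum, sum_t_mul_star_t h h0 h1,
          mul_one, projA_apply]

lemma A.actK_star (q : Param) (z : ℝ) (x : A q) :
    A.actK q z (star x) = star (A.actK q (-z) x) := by
  induction x using A.induction q with
  | hs z => simp [← algebraMap_star_comm]
  | hadd x y hx hy => simp [hx, hy]
  | hmul x y hx hy => simp [hx, hy]
  | hg g =>
    cases g <;> simp only [A.star_gen, A.starGen, A.actK, A.lift_gen, map_neg, map_smul,
      star_smul, smul_neg] <;>
      simp [conj_qpow, neg_div, smul_smul, mul_comm]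

/-- Under the counit the left and right torus actions agree up to inversion: `b` and `c`, on which
they would differ, are sent to `0`. -/
lemma A.counit_actK (q : Param) (z : ℝ) (x : A q) :
    A.counit q (A.actK q z x) = A.counit q (A.pdK q (-z) x) := by
  induction x using A.induction q with
  | hs z => simp
  | hadd x y hx hy => simp [hx, hy]
  | hmul x y hx hy => simp [hx, hy]
  | hg g => cases g <;> simp [A.counit, A.actK, A.pdK, neg_div]

lemma coe_theta_symm (q : Param) (x : S2 q) : ((theta q).symm x : A q) = A.actK q 2 x :=
  act_K_sq q x

lemma actK_projA (q : Param) (N : ℤ) (z : ℝ) (i j : Fin (N.natAbs + 1)) :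
    A.actK q z (projA q N i j) = qpow q (z * ((j : ℝ) - i)) • projA q N i j := by
  obtain ⟨x, y, lam, h, h0, -, -⟩ := exists_isSpinHalfPair_t q N
  have hi : (i : ℕ) ≤ N.natAbs := by omega
  have hj : (j : ℕ) ≤ N.natAbs := by omega
  rw [projA_apply, map_smul, map_mul, A.actK_star, actK_t h h0 _ hi, actK_t h h0 _ hj, star_smul,
    show ∀ w, star (qpow q w) = qpow q w from conj_qpow q, smul_mul_smul_comm, ← qpow_add,
    smul_comm]
  congr 2
  ring

lemma spinK_weight_smul_theta_symm_proj (q : Param) (N : ℤ) (i j : Fin (N.natAbs + 1)) :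
    qpow q (-2 * ((j : ℝ) - N.natAbs / 2)) • (theta q).symm (proj q N i j)
      = qpow q (-2 * ((i : ℝ) - N.natAbs / 2)) • proj q N i j := by
  apply Subtype.ext
  change _ • ((theta q).symm (proj q N i j) : A q) = _ • projA q N i j
  rw [coe_theta_symm]
  change _ • A.actK q 2 (projA q N i j) = _
  rw [actK_projA, smul_smul, ← qpow_add]
  congr 2
  ring

/-- The counit turns `K² ▷` into `∂_{K^(-2)}`, which fixes the sphere pointwise. -/
lemma counit_theta_symm (q : Param) (x : S2 q) : counit q ((theta q).symm x) = counit q x := by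
  have h : A.pdK q (-2) (x : A q) = x := by
    conv_lhs => rw [← (mem_S2 q _).1 x.2]
    rw [A.pdK_pdK, neg_add_cancel, A.pdK_zero]
  change A.counit q ((theta q).symm x : A q) = A.counit q x
  rw [coe_theta_symm, A.counit_actK, h]

lemma exists_sum_spinK_weight_smul_proj (q : Param) (N : ℤ) : ∃ c : ℂ,
    ∑ i : Fin (N.natAbs + 1), qpow q (-2 * ((i : ℝ) - N.natAbs / 2)) • proj q N i i
      = algebraMap ℂ (S2 q) c := by
  obtain ⟨x, y, lam, h, h0, -, h2⟩ := exists_isSpinHalfPair_t q N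
  refine ⟨lam ^ N.natAbs, Subtype.ext ?_⟩
  rw [AddSubmonoidClass.coe_finsetSum]
  change ∑ i, _ • projA q N i i = algebraMap ℂ (A q) (lam ^ N.natAbs)
  -- On the diagonal the factors from `ρ°(K⁻¹)` and `ρ°(K)` cancel, leaving the weighted sum of `t*
  -- t`.
  simp only [projA_apply, sub_self, qpow_zero, one_smul]
  exact sum_star_t_mul_t h h0 h2

end Podles
end

theorem mainTheorem11 (q : Podles.Param) (N : ℤ) :
    Podles.IsTwistedHochschildTwoCycle (Podles.theta q).symm (Podles.chBar q N) := by
  obtain ⟨c, hc⟩ := Podles.exists_sum_spinK_weight_smul_proj q N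
  rw [Podles.chBar, Podles.rho_K_sq]
  refine Podles.isTwistedHochschildTwoCycle_of_idempotent (Podles.theta q).symm _ (Podles.proj q N)
    (Podles.counit q) (Podles.proj_mul_proj q N)
    (Podles.spinK_weight_smul_theta_symm_proj q N) (fun i j => ?_) c hc
  -- Applying the `θ⁻¹`-invariant counit to the covariance relation shows that `ε(P_N)` commutes
  -- with the weight matrix.
  have h := congrArg (Podles.counit q) (Podles.spinK_weight_smul_theta_symm_proj q N i j)
  rwa [map_smul, map_smul, Podles.counit_theta_symm] at h
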